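/- Let $s,t,r\in\mathbb{C}$ and let $\mathbb{D}$ be the open unit disc in $\mathbb{C}$. Write $\partial=\tfrac12(\partial_x-i\partial_y)$ and $\bar\partial=\tfrac12(\partial_x+i\partial_y)$, put $(x,y)_0=1$, $(x,y)_n=x(x+y)(x+2y)\cdots(x+(n-1)y)$ and $(x)_n=(x,1)_n$, and let $$\mathcal{P}(\alpha,\beta\,|\,\gamma;z)=\sum_{n=0}^{\infty}\frac{(\alpha,\beta)_n}{(\gamma)_n}\frac{z^n}{n!}.$$ (1) A function $u:\mathbb{D}\to\mathbb{C}$ is twice continuously differentiable and satisfies $$\partial\bar\partial u-sz\,\partial u-t\bar z\,\bar\partial u-ru=0\quad\text{in }\mathbb{D}$$ if and only if there is a family $\{k_m\}_{m\in\mathbb{Z}}$ of complex numbers with $$\limsup_{|m|\to\infty}|k_m|^{1/|m|}\le 1 \tag{$*$}$$ such that, for every $z\in\mathbb{D}$, both of the following series converge and $$u(z)=\sum_{m=0}^{\infty}k_m\,\mathcal{P}(r+sm,s+t\,|\,m+1;|z|^2)\,z^m+\sum_{m=1}^{\infty}k_{-m}\,\mathcal{P}(r+tm,t+s\,|\,m+1;|z|^2)\,\bar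 z^m. \tag{$**$}$$ (2) Whenever $\{k_m\}_{m\in\mathbb{Z}}$ satisfies $(*)$, the series in $(**)$ is absolutely convergent in $C^\infty(\mathbb{D})$: all its terms are smooth, the sum over all terms $f$ of $\|f\|_{j,l,K}=\max_{z\in K}|\partial^j\bar\partial^l f(z)|$ is finite for all integers $j,l\ge 0$ and all compact $K\subset\mathbb{D}$, and the series converges with respect to each of these seminorms to its pointwise sum, which is a smooth function on $\mathbb{D}$. -/

import Mathlib

open scoped ENNReal ContDiff

noncomputable section

namespace GenHarm

/-- The open unit disc. -/
def disc : Set ℂ := Metric.ball 0 1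

/-- The complex derivative `∂ = (∂ₓ - i ∂_y) / 2`. -/
def dz (f : ℂ → ℂ) (z : ℂ) : ℂ :=
  (fderiv ℝ f z 1 - Complex.I * fderiv ℝ f z Complex.I) / 2

/-- The complex derivative `∂̄ = (∂ₓ + i ∂_y) / 2`. -/
def dbar (f : ℂ → ℂ) (z : ℂ) : ℂ :=
  (fderiv ℝ f z 1 + Complex.I * fderiv ℝ f z Complex.I) / 2

/-- The operator `M_{s,t,r} = ∂∂̄ - s z ∂ - t z̄ ∂̄ - r`. -/
def opM (s t r : ℂ) (u : ℂ → ℂ) (z : ℂ) : ℂ :=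
  dz (dbar u) z - s * z * dz u z - t * starRingEnd ℂ z * dbar u z - r * u z

/-- `u` is a solution on the unit disc: it is `C²` there and `M_{s,t,r} u = 0` there
(the values of `u` outside the disc are irrelevant). -/
def IsSolution (s t r : ℂ) (u : ℂ → ℂ) : Prop :=
  ContDiffOn ℝ 2 u disc ∧ ∀ z ∈ disc, opM s t r u z = 0

/-- The generalised Pochhammer symbol `(x,y)_n = x (x+y) (x+2y) ⋯ (x+(n-1)y)`. -/
def poch (x y : ℂ) (n : ℕ) : ℂ := ∏ i ∈ Finset.range n, (x + i * y)

/-- `𝒫(α, β | γ; z) = ∑_{k ≥ 0} (α,β)_k / (γ)_k · z^k / k!`, where `(γ)_k = (γ,1)_k`. -/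
def calP (α β γ z : ℂ) : ℂ :=
  ∑' k : ℕ, poch α β k / poch γ 1 k * (z ^ k / (k.factorial : ℂ))

/-- The `m`-th term of the expansion, `m ∈ ℤ`:
`k_m 𝒫(r+sm, s+t | m+1; |z|²) z^m` for `m ≥ 0` and
`k_m 𝒫(r+t|m|, t+s | |m|+1; |z|²) z̄^|m|` for `m < 0`. -/
def term (s t r : ℂ) (k : ℤ → ℂ) (m : ℤ) (z : ℂ) : ℂ :=
  if 0 ≤ m then
    k m * calP (r + s * m.natAbs) (s + t) (m.natAbs + 1) ((‖z‖ : ℂ) ^ 2) * z ^ m.natAbs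
  else
    k m * calP (r + t * m.natAbs) (t + s) (m.natAbs + 1) ((‖z‖ : ℂ) ^ 2) *
      starRingEnd ℂ z ^ m.natAbs

/-- `limsup_{|m| → ∞} |k_m|^{1/|m|} ≤ 1`, the upper limit being taken in `[0, ∞]`. -/
def RootCondition (k : ℤ → ℂ) : Prop :=
  Filter.limsup (fun m : ℤ => ‖k m‖ₑ ^ (1 / (m.natAbs : ℝ)))
    (Filter.comap (fun m : ℤ => |m|) Filter.atTop) ≤ 1

/-- The semi-norm `‖f‖_{j,l,K} = max_{z ∈ K} |∂^j ∂̄^l f(z)|`. -/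
def smoothSeminorm (j l : ℕ) (K : Set ℂ) (f : ℂ → ℂ) : ℝ :=
  ⨆ z : K, ‖dz^[j] (dbar^[l] f) z‖

/-- The family `f` consists of smooth functions on the disc and is absolutely summable with
respect to each of the semi-norms of `C^∞(𝔻)`. -/
def AbsConvergent (f : ℤ → ℂ → ℂ) : Prop :=
  (∀ m, ContDiffOn ℝ ∞ (f m) disc) ∧
    ∀ (j l : ℕ) (K : Set ℂ), IsCompact K → K ⊆ disc →
      Summable fun m : ℤ => smoothSeminorm j l K (f m)

/-- `∑_{m ∈ ℤ} f_m = u` with (unconditional) convergence in `C^∞(𝔻)`. -/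
def HasSmoothSum (f : ℤ → ℂ → ℂ) (u : ℂ → ℂ) : Prop :=
  ContDiffOn ℝ ∞ u disc ∧
    ∀ (j l : ℕ) (K : Set ℂ), IsCompact K → K ⊆ disc →
      Filter.Tendsto
        (fun F : Finset ℤ => smoothSeminorm j l K (fun z => (∑ m ∈ F, f m z) - u z))
        Filter.atTop (nhds 0)

end GenHarm

end

noncomputable section

namespace GenHarm

open Filter Topology

/-! ### Double power series in `z` and `z̄` -/

/-! Both directions pass through double power series $\sum c_{p,q}z^p\bar z^q$. Comparing
coefficients, such a series solves the equation as soon as $(p+1)(q+1)c_{p+1,q+1}=(sp+tq+r)c_{p,q}$.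
This recurrence runs along the diagonals $p-q=m$, and on each of them the coefficients of the $m$-th
term of the expansion satisfy it (`hypCoeff_succ`). They are at most $A^n/n!$ with $A=|s|+|t|+|r|$,
uniformly in $m$ (`norm_hypCoeff_le`), so under the root condition the double series converges
absolutely for every radius below 1 (`RootCondition.discSummable`). Termwise differentiation then
gives the "if" part of (1), and grouping by diagonals gives (2).

Conversely, let $u$ be a $C^2$ solution. On circles of radius $x$, the $m$-th Fourier coefficient of
$u$ and the $(m+1)$-st of $\bar\partial u$ satisfy a linear $2\times2$ system in $x$, singular at
$0$ (`IsSolution.radialSystem`). Continuity at $0$ kills the weighted Wronskian of any two such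
pairs, so the coefficient of $u$ is a multiple $k_m$ of that of the normalised $m$-th term
(`RadialSystem.exists_eq_const_mul`). As $|m|\to\infty$ the factor $\mathcal P$ tends to an
exponential, which has no zeros (`tendsto_calP_atTop`); hence boundedness of $u$ on the circle of
radius $R$ bounds $|k_m|R^{|m|}$, and letting $R\to1$ gives the root condition. The Fourier series
of $u$ is then absolutely convergent and returns $u$. -/

/-- The double series `∑ c_{p,q} z^p z̄^q` converges absolutely on the unit disc. -/
def DiscSummable (c : ℕ × ℕ → ℂ) : Prop :=
  ∀ R : ℝ, 0 < R → R < 1 → Summable fun i => ‖c i‖ * R ^ (i.1 + i.2)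

/-- The sum of the double series `∑ c_{p,q} z^p z̄^q`. -/
def dblSum (c : ℕ × ℕ → ℂ) (z : ℂ) : ℂ :=
  ∑' i : ℕ × ℕ, c i * (z ^ i.1 * starRingEnd ℂ z ^ i.2)

/-- The coefficients of `∂` of a double series. -/
def coeffDz (c : ℕ × ℕ → ℂ) (i : ℕ × ℕ) : ℂ := (i.1 + 1 : ℕ) * c (i.1 + 1, i.2)

/-- The coefficients of `∂̄` of a double series. -/
def coeffDbar (c : ℕ × ℕ → ℂ) (i : ℕ × ℕ) : ℂ := (i.2 + 1 : ℕ) * c (i.1, i.2 + 1)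

/-- The part of a double series whose degrees of homogeneity, shifted by `a`, lie in `T`. -/
def restr (a : ℤ) (T : Set ℤ) (c : ℕ × ℕ → ℂ) : ℕ × ℕ → ℂ :=
  Set.indicator {i | (i.1 : ℤ) - i.2 + a ∈ T} c

theorem isOpen_disc : IsOpen disc := Metric.isOpen_ball

theorem mem_disc {z : ℂ} : z ∈ disc ↔ ‖z‖ < 1 := by simp [disc]

theorem exists_nat_mul_pow_le {R R' : ℝ} (hR : 0 < R) (hRR : R < R') :
    ∃ C : ℝ, ∀ n : ℕ, n * R ^ (n - 1) ≤ C * R' ^ n := by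
  have hR' : 0 < R' := hR.trans hRR
  have h := tendsto_pow_const_mul_const_pow_of_lt_one 1 (r := R / R') (by positivity)
    ((div_lt_one hR').2 hRR)
  obtain ⟨C, hC⟩ := h.bddAbove_range
  refine ⟨C / R, fun n => ?_⟩
  have hn : (n : ℝ) ^ 1 * (R / R') ^ n ≤ C := hC ⟨n, rfl⟩
  rcases n with _ | n
  · simpa using div_nonneg (by simpa using hn) hR.le
  · have : ((n + 1 : ℕ) : ℝ) * R ^ (n + 1 - 1)
        = ((n + 1 : ℕ) : ℝ) ^ 1 * (R / R') ^ (n + 1) / R * R' ^ (n + 1) := by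
      rw [div_pow, pow_succ R]
      field_simp
      simp
    rw [this]
    gcongr

/-- The factor $p+q$ produced by differentiation is absorbed by passing to the radius $(R+1)/2$.
This is the majorant behind every termwise differentiation below. -/
theorem DiscSummable.summable_deriv {c : ℕ × ℕ → ℂ} (hc : DiscSummable c) {R : ℝ} (hR : 0 < R)
    (hR1 : R < 1) :
    Summable fun i => ‖c i‖ * ((i.1 + i.2 : ℕ) * R ^ (i.1 + i.2 - 1)) := by
  obtain ⟨C, hC⟩ := exists_nat_mul_pow_le hR (R' := (R + 1) / 2) (by linarith)
  refine ((hc ((R + 1) / 2) (by linarith) (by linarith)).mul_left C).of_nonneg_of_le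
    (fun i => by positivity) (fun i => ?_)
  calc _ ≤ ‖c i‖ * (C * ((R + 1) / 2) ^ (i.1 + i.2)) := mul_le_mul_of_nonneg_left (hC _) (norm_nonneg _)
    _ = _ := by ring

theorem injective_succ_left : Function.Injective fun i : ℕ × ℕ => (i.1 + 1, i.2) := by
  rintro ⟨a, b⟩ ⟨a', b'⟩ h; simpa using h

theorem injective_succ_right : Function.Injective fun i : ℕ × ℕ => (i.1, i.2 + 1) := by
  rintro ⟨a, b⟩ ⟨a', b'⟩ h; simpa using h

theorem DiscSummable.coeffDz {c : ℕ × ℕ → ℂ} (hc : DiscSummable c) :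
    DiscSummable (coeffDz c) := by
  intro R hR hR1
  refine ((hc.summable_deriv hR hR1).comp_injective injective_succ_left).of_nonneg_of_le
    (fun i => by positivity) (fun i => ?_)
  simp only [Function.comp, GenHarm.coeffDz, norm_mul, Complex.norm_natCast]
  rw [show i.1 + 1 + i.2 - 1 = i.1 + i.2 by omega, mul_comm (_ : ℝ) ‖c _‖, mul_assoc]
  have h : i.1 + 1 ≤ i.1 + 1 + i.2 := by omega
  gcongr

theorem DiscSummable.coeffDbar {c : ℕ × ℕ → ℂ} (hc : DiscSummable c) :
    DiscSummable (coeffDbar c) := by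
  intro R hR hR1
  refine ((hc.summable_deriv hR hR1).comp_injective injective_succ_right).of_nonneg_of_le
    (fun i => by positivity) (fun i => ?_)
  simp only [Function.comp, GenHarm.coeffDbar, norm_mul, Complex.norm_natCast]
  rw [show i.1 + (i.2 + 1) - 1 = i.1 + i.2 by omega, mul_comm (_ : ℝ) ‖c _‖, mul_assoc]
  have h : i.2 + 1 ≤ i.1 + (i.2 + 1) := by omega
  gcongr

theorem DiscSummable.mono {c d : ℕ × ℕ → ℂ} (hc : DiscSummable c) (h : ∀ i, ‖d i‖ ≤ ‖c i‖) :
    DiscSummable d := fun R hR hR1 =>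
  (hc R hR hR1).of_nonneg_of_le (fun _ => by positivity) fun i => by gcongr; exact h i

theorem DiscSummable.restr {c : ℕ × ℕ → ℂ} (hc : DiscSummable c) (a : ℤ) (T : Set ℤ) :
    DiscSummable (restr a T c) :=
  hc.mono fun _ => norm_indicator_le_norm_self _ _

theorem norm_monomial_le {z : ℂ} {R : ℝ} (hz : ‖z‖ ≤ R) (p q : ℕ) :
    ‖z ^ p * starRingEnd ℂ z ^ q‖ ≤ R ^ (p + q) := by
  rw [norm_mul, norm_pow, norm_pow, RCLike.norm_conj, ← pow_add]
  gcongr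

theorem DiscSummable.summable_norm {c : ℕ × ℕ → ℂ} (hc : DiscSummable c) {z : ℂ}
    (hz : z ∈ disc) : Summable fun i : ℕ × ℕ => ‖c i * (z ^ i.1 * starRingEnd ℂ z ^ i.2)‖ := by
  rw [mem_disc] at hz
  have h0 := norm_nonneg z
  refine (hc ((‖z‖ + 1) / 2) (by linarith) (by linarith)).of_nonneg_of_le
    (fun _ => by positivity) fun i => ?_
  rw [norm_mul]
  gcongr
  exact norm_monomial_le (by linarith) _ _

theorem DiscSummable.hasSum {c : ℕ × ℕ → ℂ} (hc : DiscSummable c) {z : ℂ} (hz : z ∈ disc) :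
    HasSum (fun i : ℕ × ℕ => c i * (z ^ i.1 * starRingEnd ℂ z ^ i.2)) (dblSum c z) :=
  (hc.summable_norm hz).of_norm.hasSum

theorem DiscSummable.norm_dblSum_le {c : ℕ × ℕ → ℂ} (hc : DiscSummable c) {z : ℂ} {R : ℝ}
    (hR : 0 < R) (hR1 : R < 1) (hz : ‖z‖ ≤ R) :
    ‖dblSum c z‖ ≤ ∑' i : ℕ × ℕ, ‖c i‖ * R ^ (i.1 + i.2) := by
  have hs := hc.summable_norm (z := z) (mem_disc.2 (hz.trans_lt hR1))
  refine (norm_tsum_le_tsum_norm hs).trans (hs.tsum_le_tsum (fun i => ?_) (hc R hR hR1))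
  rw [norm_mul]
  gcongr
  exact norm_monomial_le hz _ _

/-! ### Termwise differentiation of double series -/

/-- The real linear map `w ↦ a w + b w̄`. -/
def wirtinger (a b : ℂ) : ℂ →L[ℝ] ℂ :=
  a • ContinuousLinearMap.id ℝ ℂ + b • (Complex.conjCLE : ℂ →L[ℝ] ℂ)

@[simp]
theorem wirtinger_apply (a b w : ℂ) : wirtinger a b w = a * w + b * starRingEnd ℂ w := by
  simp [wirtinger]

theorem norm_wirtinger_le (a b : ℂ) : ‖wirtinger a b‖ ≤ ‖a‖ + ‖b‖ := by
  refine ContinuousLinearMap.opNorm_le_bound _ (by positivity) fun w => ?_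
  rw [wirtinger_apply, add_mul]
  refine (norm_add_le _ _).trans (by simp)

theorem dz_of_hasFDerivAt {f : ℂ → ℂ} {a b z : ℂ} (h : HasFDerivAt f (wirtinger a b) z) :
    dz f z = a := by
  rw [dz, h.fderiv]; simp; ring_nf; simp; ring

theorem dbar_of_hasFDerivAt {f : ℂ → ℂ} {a b z : ℂ} (h : HasFDerivAt f (wirtinger a b) z) :
    dbar f z = b := by
  rw [dbar, h.fderiv]; simp; ring_nf; simp; ring

theorem fderiv_eq_wirtinger (f : ℂ → ℂ) (z : ℂ) :
    fderiv ℝ f z = wirtinger (dz f z) (dbar f z) := by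
  ext w
  have hw : w = w.re • (1 : ℂ) + w.im • Complex.I := by simp
  have hI : Complex.I ^ 2 = -1 := Complex.I_sq
  conv_lhs => rw [hw, map_add, map_smul, map_smul]
  simp only [wirtinger_apply, dz, dbar, Complex.real_smul]
  conv_rhs => rw [hw]
  simp only [Complex.real_smul, map_add, map_mul, Complex.conj_ofReal, Complex.conj_I, map_one]
  linear_combination ((w.im : ℂ) * fderiv ℝ f z Complex.I) * hI

theorem hasFDerivAt_monomial (p q : ℕ) (z : ℂ) :
    HasFDerivAt (fun z : ℂ => z ^ p * starRingEnd ℂ z ^ q)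
      (wirtinger (p * z ^ (p - 1) * starRingEnd ℂ z ^ q)
        (q * z ^ p * starRingEnd ℂ z ^ (q - 1))) z := by
  have h1 : HasFDerivAt (fun z : ℂ => z ^ p) _ z :=
    ((hasDerivAt_pow p z).hasFDerivAt).restrictScalars ℝ
  have h2 : HasFDerivAt (fun z : ℂ => z ^ q) _ (starRingEnd ℂ z) :=
    ((hasDerivAt_pow q (starRingEnd ℂ z)).hasFDerivAt).restrictScalars ℝ
  have h3 : HasFDerivAt (fun z : ℂ => starRingEnd ℂ z) (Complex.conjCLE : ℂ →L[ℝ] ℂ) z :=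
    Complex.conjCLE.hasFDerivAt
  have h4 := h1.mul (h2.comp z h3)
  refine h4.congr_fderiv ?_
  ext w
  simp
  ring

theorem tsum_coeffDz (c : ℕ × ℕ → ℂ) (z : ℂ) :
    dblSum (coeffDz c) z =
      ∑' i : ℕ × ℕ, c i * (i.1 * z ^ (i.1 - 1) * starRingEnd ℂ z ^ i.2) := by
  rw [← injective_succ_left.tsum_eq
    (f := fun i : ℕ × ℕ => c i * (i.1 * z ^ (i.1 - 1) * starRingEnd ℂ z ^ i.2))]
  · refine tsum_congr fun i => ?_
    simp [coeffDz]; ring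
  · rintro ⟨_ | p, q⟩ h
    · simp at h
    · exact ⟨(p, q), rfl⟩

theorem tsum_coeffDbar (c : ℕ × ℕ → ℂ) (z : ℂ) :
    dblSum (coeffDbar c) z =
      ∑' i : ℕ × ℕ, c i * (i.2 * z ^ i.1 * starRingEnd ℂ z ^ (i.2 - 1)) := by
  rw [← injective_succ_right.tsum_eq
    (f := fun i : ℕ × ℕ => c i * (i.2 * z ^ i.1 * starRingEnd ℂ z ^ (i.2 - 1)))]
  · refine tsum_congr fun i => ?_
    simp [coeffDbar]; ring
  · rintro ⟨p, _ | q⟩ h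
    · simp at h
    · exact ⟨(p, q), rfl⟩

theorem norm_monomial_dz_le {z : ℂ} {R : ℝ} (hz : ‖z‖ ≤ R) (p q : ℕ) :
    ‖p * z ^ (p - 1) * starRingEnd ℂ z ^ q‖ ≤ p * R ^ (p + q - 1) := by
  rcases p with _ | p
  · simp
  · rw [mul_assoc, norm_mul, Complex.norm_natCast, show p + 1 + q - 1 = p + 1 - 1 + q by omega]
    gcongr
    exact norm_monomial_le hz _ _

theorem norm_monomial_dbar_le {z : ℂ} {R : ℝ} (hz : ‖z‖ ≤ R) (p q : ℕ) :
    ‖q * z ^ p * starRingEnd ℂ z ^ (q - 1)‖ ≤ q * R ^ (p + q - 1) := by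
  rcases q with _ | q
  · simp
  · rw [mul_assoc, norm_mul, Complex.norm_natCast,
      show p + (q + 1) - 1 = p + (q + 1 - 1) by omega]
    gcongr
    exact norm_monomial_le hz _ _

theorem DiscSummable.hasFDerivAt {c : ℕ × ℕ → ℂ} (hc : DiscSummable c) {z : ℂ}
    (hz : z ∈ disc) :
    HasFDerivAt (dblSum c)
      (wirtinger (dblSum (GenHarm.coeffDz c) z) (dblSum (GenHarm.coeffDbar c) z)) z := by
  rw [mem_disc] at hz
  have h0 := norm_nonneg z
  obtain ⟨R, hzR, hR1⟩ := exists_between hz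
  have hR : 0 < R := h0.trans_lt hzR
  have hsum := hc.summable_deriv hR hR1
  have key : ∀ w ∈ Metric.ball (0 : ℂ) R, ∀ i : ℕ × ℕ,
      ‖c i * (i.1 * w ^ (i.1 - 1) * starRingEnd ℂ w ^ i.2)‖
      + ‖c i * (i.2 * w ^ i.1 * starRingEnd ℂ w ^ (i.2 - 1))‖
      ≤ ‖c i‖ * ((i.1 + i.2 : ℕ) * R ^ (i.1 + i.2 - 1)) := by
    intro w hw i
    have hw' : ‖w‖ ≤ R := by simpa using (Metric.mem_ball.1 hw).le
    rw [norm_mul, norm_mul (c i), ← mul_add]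
    gcongr
    -- The two Wirtinger parts contribute $p$ and $q$ times the same power of $R$, hence the total
    -- degree $p+q$.
    refine (add_le_add (norm_monomial_dz_le hw' _ _) (norm_monomial_dbar_le hw' _ _)).trans ?_
    push_cast; rw [add_mul]
  have hzb : z ∈ Metric.ball (0 : ℂ) R := by simpa using hzR
  have h := hasFDerivAt_tsum_of_isPreconnected (𝕜 := ℝ)
    (f := fun (i : ℕ × ℕ) (w : ℂ) => c i * (w ^ i.1 * starRingEnd ℂ w ^ i.2))
    (f' := fun (i : ℕ × ℕ) (w : ℂ) => wirtinger
      (c i * (i.1 * w ^ (i.1 - 1) * starRingEnd ℂ w ^ i.2))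
      (c i * (i.2 * w ^ i.1 * starRingEnd ℂ w ^ (i.2 - 1))))
    (s := Metric.ball (0 : ℂ) R) (x₀ := z) (x := z) hsum Metric.isOpen_ball
    (convex_ball _ _).isPreconnected
    (fun i w _ => by
      refine ((hasFDerivAt_monomial i.1 i.2 w).const_mul (c i)).congr_fderiv ?_
      ext v; simp; ring)
    (fun i w hw => (norm_wirtinger_le _ _).trans (key w hw i)) hzb
    (hc.summable_norm (mem_disc.2 hz)).of_norm hzb
  refine h.congr_fderiv ?_
  have hs1 : Summable fun i : ℕ × ℕ => c i * (i.1 * z ^ (i.1 - 1) * starRingEnd ℂ z ^ i.2) :=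
    Summable.of_norm_bounded hsum fun i =>
      (le_add_of_nonneg_right (norm_nonneg _)).trans (key z hzb i)
  have hs2 : Summable fun i : ℕ × ℕ => c i * (i.2 * z ^ i.1 * starRingEnd ℂ z ^ (i.2 - 1)) :=
    Summable.of_norm_bounded hsum fun i =>
      (le_add_of_nonneg_left (norm_nonneg _)).trans (key z hzb i)
  have hs3 : Summable fun i : ℕ × ℕ => wirtinger
      (c i * (i.1 * z ^ (i.1 - 1) * starRingEnd ℂ z ^ i.2))
      (c i * (i.2 * z ^ i.1 * starRingEnd ℂ z ^ (i.2 - 1))) :=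
    Summable.of_norm_bounded hsum fun i => (norm_wirtinger_le _ _).trans (key z hzb i)
  ext w
  rw [wirtinger_apply, tsum_coeffDz, tsum_coeffDbar, ← tsum_mul_right, ← tsum_mul_right,
    ← (hs1.mul_right w).tsum_add (hs2.mul_right _)]
  rw [← ContinuousLinearMap.apply_apply w (∑' i, _),
    (ContinuousLinearMap.apply ℝ ℂ w).map_tsum hs3]
  simp

theorem DiscSummable.dz_dblSum {c : ℕ × ℕ → ℂ} (hc : DiscSummable c) :
    Set.EqOn (dz (dblSum c)) (dblSum (GenHarm.coeffDz c)) disc :=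
  fun _ hz => dz_of_hasFDerivAt (hc.hasFDerivAt hz)

theorem DiscSummable.dbar_dblSum {c : ℕ × ℕ → ℂ} (hc : DiscSummable c) :
    Set.EqOn (dbar (dblSum c)) (dblSum (GenHarm.coeffDbar c)) disc :=
  fun _ hz => dbar_of_hasFDerivAt (hc.hasFDerivAt hz)

theorem contDiffOn_wirtinger {n : ℕ∞ω} {a b : ℂ → ℂ} {s : Set ℂ}
    (ha : ContDiffOn ℝ n a s) (hb : ContDiffOn ℝ n b s) :
    ContDiffOn ℝ n (fun z => wirtinger (a z) (b z)) s := by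
  unfold wirtinger
  exact (ha.smul contDiffOn_const).add (hb.smul contDiffOn_const)

/-- The derivative is assembled from two double series of the same kind, so the induction runs over
all coefficient families at once. -/
theorem DiscSummable.contDiffOn_nat (n : ℕ) {c : ℕ × ℕ → ℂ} (hc : DiscSummable c) :
    ContDiffOn ℝ n (dblSum c) disc := by
  induction n generalizing c with
  | zero =>
    exact contDiffOn_zero.2 fun z hz => (hc.hasFDerivAt hz).continuousAt.continuousWithinAt
  | succ n ih =>
    push_cast
    rw [contDiffOn_succ_iff_fderiv_of_isOpen isOpen_disc]
    refine ⟨fun z hz => (hc.hasFDerivAt hz).differentiableAt.differentiableWithinAt,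
      by simp, ?_⟩
    exact (contDiffOn_wirtinger (ih hc.coeffDz) (ih hc.coeffDbar)).congr
      fun z hz => (hc.hasFDerivAt hz).fderiv

theorem DiscSummable.contDiffOn {c : ℕ × ℕ → ℂ} (hc : DiscSummable c) :
    ContDiffOn ℝ ∞ (dblSum c) disc :=
  contDiffOn_infty.2 fun n => hc.contDiffOn_nat n

theorem dz_eqOn {f g : ℂ → ℂ} (h : Set.EqOn f g disc) : Set.EqOn (dz f) (dz g) disc := by
  intro z hz
  rw [dz, dz, (h.eventuallyEq_of_mem (isOpen_disc.mem_nhds hz)).fderiv_eq]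

theorem dbar_eqOn {f g : ℂ → ℂ} (h : Set.EqOn f g disc) : Set.EqOn (dbar f) (dbar g) disc := by
  intro z hz
  rw [dbar, dbar, (h.eventuallyEq_of_mem (isOpen_disc.mem_nhds hz)).fderiv_eq]

theorem opM_eqOn (s t r : ℂ) {f g : ℂ → ℂ} (h : Set.EqOn f g disc) :
    Set.EqOn (opM s t r f) (opM s t r g) disc := by
  intro z hz
  rw [opM, opM, dz_eqOn (dbar_eqOn h) hz, dz_eqOn h hz, dbar_eqOn h hz, h hz]

theorem DiscSummable.iterate_coeffDz (j : ℕ) {c : ℕ × ℕ → ℂ} (hc : DiscSummable c) :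
    DiscSummable (GenHarm.coeffDz^[j] c) := by
  induction j with
  | zero => exact hc
  | succ j ih => rw [Function.iterate_succ_apply']; exact ih.coeffDz

theorem DiscSummable.iterate_coeffDbar (j : ℕ) {c : ℕ × ℕ → ℂ} (hc : DiscSummable c) :
    DiscSummable (GenHarm.coeffDbar^[j] c) := by
  induction j with
  | zero => exact hc
  | succ j ih => rw [Function.iterate_succ_apply']; exact ih.coeffDbar

theorem iterate_dbar_eqOn (j : ℕ) {f : ℂ → ℂ} {c : ℕ × ℕ → ℂ} (hc : DiscSummable c)
    (h : Set.EqOn f (dblSum c) disc) :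
    Set.EqOn (dbar^[j] f) (dblSum (coeffDbar^[j] c)) disc := by
  induction j with
  | zero => exact h
  | succ j ih =>
    rw [Function.iterate_succ_apply', Function.iterate_succ_apply']
    exact (dbar_eqOn ih).trans (hc.iterate_coeffDbar j).dbar_dblSum

theorem iterate_dz_eqOn (j : ℕ) {f : ℂ → ℂ} {c : ℕ × ℕ → ℂ} (hc : DiscSummable c)
    (h : Set.EqOn f (dblSum c) disc) :
    Set.EqOn (dz^[j] f) (dblSum (coeffDz^[j] c)) disc := by
  induction j with
  | zero => exact h
  | succ j ih =>
    rw [Function.iterate_succ_apply', Function.iterate_succ_apply']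
    exact (dz_eqOn ih).trans (hc.iterate_coeffDz j).dz_dblSum

/-! ### Splitting by homogeneity degree and convergence in $C^\infty(\mathbb D)$ -/

open Classical in
theorem restr_apply (a : ℤ) (T : Set ℤ) (c : ℕ × ℕ → ℂ) (i : ℕ × ℕ) :
    restr a T c i = if (i.1 : ℤ) - i.2 + a ∈ T then c i else 0 := by
  simp [restr, Set.indicator]

theorem coeffDz_restr (a : ℤ) (T : Set ℤ) (c : ℕ × ℕ → ℂ) :
    coeffDz (restr a T c) = restr (a + 1) T (coeffDz c) := by
  funext i
  have e : ((i.1 + 1 : ℕ) : ℤ) - i.2 + a = i.1 - i.2 + (a + 1) := by push_cast; ring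
  simp only [coeffDz, restr_apply, mul_ite, mul_zero]
  rw [e]

theorem coeffDbar_restr (a : ℤ) (T : Set ℤ) (c : ℕ × ℕ → ℂ) :
    coeffDbar (restr a T c) = restr (a - 1) T (coeffDbar c) := by
  funext i
  have e : (i.1 : ℤ) - (i.2 + 1 : ℕ) + a = i.1 - i.2 + (a - 1) := by push_cast; ring
  simp only [coeffDbar, restr_apply, mul_ite, mul_zero]
  rw [e]

/-- Each $\partial$ lowers $p-q$ by one and each $\bar\partial$ raises it by one; the shift $j-l$
recovers the degree before differentiation, so $T$ itself never changes. -/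
theorem iterate_coeff_restr (j l : ℕ) (T : Set ℤ) (c : ℕ × ℕ → ℂ) :
    coeffDz^[j] (coeffDbar^[l] (restr 0 T c)) =
      restr (j - l) T (coeffDz^[j] (coeffDbar^[l] c)) := by
  have h1 : coeffDbar^[l] (restr 0 T c) = restr (-l) T (coeffDbar^[l] c) := by
    induction l with
    | zero => simp
    | succ l ih =>
      rw [Function.iterate_succ_apply', ih, coeffDbar_restr, ← Function.iterate_succ_apply' coeffDbar]
      congr 1; push_cast; ring
  rw [h1]
  induction j with
  | zero => simp
  | succ j ih =>
    rw [Function.iterate_succ_apply', ih, coeffDz_restr, ← Function.iterate_succ_apply' coeffDz]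
    congr 1; push_cast; ring

theorem exists_radius {K : Set ℂ} (hK : IsCompact K) (hKd : K ⊆ disc) :
    ∃ R : ℝ, 0 < R ∧ R < 1 ∧ ∀ z ∈ K, ‖z‖ ≤ R := by
  rcases K.eq_empty_or_nonempty with rfl | hne
  · exact ⟨1 / 2, by norm_num, by norm_num, by simp⟩
  · obtain ⟨w, hw, hmax⟩ := hK.exists_isMaxOn hne continuous_norm.continuousOn
    have := mem_disc.1 (hKd hw)
    have h0 := norm_nonneg w
    exact ⟨(‖w‖ + 1) / 2, by linarith, by linarith, fun z hz => by
      have : ‖z‖ ≤ ‖w‖ := hmax hz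
      linarith⟩

theorem smoothSeminorm_nonneg (j l : ℕ) (K : Set ℂ) (f : ℂ → ℂ) :
    0 ≤ smoothSeminorm j l K f := Real.iSup_nonneg fun _ => norm_nonneg _

theorem smoothSeminorm_le (j l : ℕ) {K : Set ℂ} (hKd : K ⊆ disc) {R : ℝ} (hR : 0 < R)
    (hR1 : R < 1) (hK : ∀ z ∈ K, ‖z‖ ≤ R) {f : ℂ → ℂ} {c : ℕ × ℕ → ℂ} (hc : DiscSummable c)
    (T : Set ℤ) (h : Set.EqOn f (dblSum (restr 0 T c)) disc) :
    smoothSeminorm j l K f ≤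
      ∑' i : ℕ × ℕ, ‖restr (j - l) T (coeffDz^[j] (coeffDbar^[l] c)) i‖ * R ^ (i.1 + i.2) := by
  refine Real.iSup_le (fun z => ?_) (tsum_nonneg fun i => by positivity)
  have hd := (hc.restr 0 T).iterate_coeffDbar l
  rw [iterate_dz_eqOn j hd (iterate_dbar_eqOn l (hc.restr 0 T) h) (hKd z.2),
    iterate_coeff_restr]
  exact (((hc.iterate_coeffDbar l).iterate_coeffDz j).restr _ _).norm_dblSum_le hR hR1 (hK _ z.2)

/-- Summation along the fibres of a map. -/
theorem hasSum_fibre {ι κ E : Type*} [DecidableEq κ] [NormedAddCommGroup E] [CompleteSpace E]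
    (π : ι → κ) {f : ι → E} {a : E} (h : HasSum f a) :
    HasSum (fun m => ∑' i, if π i = m then f i else 0) a := by
  have hinj : Function.Injective fun i => (π i, i) := fun i j hij => (Prod.mk.inj hij).2
  have h2 : HasSum (fun x : κ × ι => if π x.2 = x.1 then f x.2 else 0) a := by
    rw [← hinj.hasSum_iff]
    · simpa [Function.comp_def] using h
    · rintro ⟨m, i⟩ hx
      refine if_neg fun he => hx ⟨i, ?_⟩
      simpa using he
  exact h2.prod_fiberwise fun m => (h2.summable.comp_injective
    (Prod.mk_right_injective m)).hasSum

theorem restr_singleton (a m : ℤ) (c : ℕ × ℕ → ℂ) (i : ℕ × ℕ) :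
    restr a {m} c i = if (i.1 : ℤ) - i.2 + a = m then c i else 0 := by
  simp [restr, Set.indicator]

theorem DiscSummable.hasSum_restr {c : ℕ × ℕ → ℂ} (hc : DiscSummable c) {z : ℂ}
    (hz : z ∈ disc) : HasSum (fun m : ℤ => dblSum (GenHarm.restr 0 {m} c) z) (dblSum c z) := by
  have h := hasSum_fibre (fun i : ℕ × ℕ => (i.1 : ℤ) - i.2 + 0) (hc.hasSum hz)
  refine h.congr_fun fun m => ?_
  refine tsum_congr fun i => ?_
  rw [restr_singleton]
  split_ifs <;> simp

/-- After differentiation, distinct terms still use disjoint sets of coefficients. Their seminorms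
are therefore bounded by the fibre sums of one absolutely convergent double series. -/
theorem DiscSummable.absConvergent {c : ℕ × ℕ → ℂ} (hc : DiscSummable c) {f : ℤ → ℂ → ℂ}
    (hf : ∀ m, Set.EqOn (f m) (dblSum (GenHarm.restr 0 {m} c)) disc) : AbsConvergent f := by
  refine ⟨fun m => (hc.restr 0 {m}).contDiffOn.congr (hf m), fun j l K hK hKd => ?_⟩
  obtain ⟨R, hR, hR1, hKR⟩ := exists_radius hK hKd
  have hD := (hc.iterate_coeffDbar l).iterate_coeffDz j
  have h := (hasSum_fibre (fun i : ℕ × ℕ => (i.1 : ℤ) - i.2 + (j - l))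
    (hD R hR hR1).hasSum).summable
  refine h.of_nonneg_of_le (fun m => smoothSeminorm_nonneg _ _ _ _) fun m => ?_
  refine (smoothSeminorm_le j l hKd hR hR1 hKR hc {m} (hf m)).trans (le_of_eq ?_)
  refine tsum_congr fun i => ?_
  rw [restr_singleton]
  split_ifs <;> simp

/-- The error of a partial sum is again a restricted double series, so `smoothSeminorm_le` applies
to it directly. -/
theorem DiscSummable.sub_dblSum {c : ℕ × ℕ → ℂ} (hc : DiscSummable c) (F : Finset ℤ) {z : ℂ}
    (hz : z ∈ disc) :
    (∑ m ∈ F, dblSum (GenHarm.restr 0 {m} c) z) - dblSum c z =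
      dblSum (GenHarm.restr 0 (Fᶜ : Set ℤ) (-c)) z := by
  have hn : DiscSummable (-c) := hc.mono fun i => by simp
  have h1 := hasSum_sum fun m (_ : m ∈ F) => (hc.restr 0 {m}).hasSum hz
  refine ((h1.sub (hc.hasSum hz)).unique ?_)
  refine ((hn.restr 0 (Fᶜ : Set ℤ)).hasSum hz).congr_fun fun i => ?_
  by_cases h : (i.1 : ℤ) - i.2 ∈ F <;> simp [restr_apply, h]

theorem DiscSummable.hasSmoothSum {c : ℕ × ℕ → ℂ} (hc : DiscSummable c) {f : ℤ → ℂ → ℂ}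
    {u : ℂ → ℂ} (hf : ∀ m, Set.EqOn (f m) (dblSum (GenHarm.restr 0 {m} c)) disc)
    (hu : Set.EqOn u (dblSum c) disc) : HasSmoothSum f u := by
  refine ⟨hc.contDiffOn.congr hu, fun j l K hK hKd => ?_⟩
  obtain ⟨R, hR, hR1, hKR⟩ := exists_radius hK hKd
  have hn : DiscSummable (-c) := hc.mono fun i => by simp
  have hD := (hn.iterate_coeffDbar l).iterate_coeffDz j
  set d := GenHarm.coeffDz^[j] (GenHarm.coeffDbar^[l] (-c)) with hd
  have hlim : Tendsto (fun F : Finset ℤ => ∑' i : ℕ × ℕ,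
      ‖GenHarm.restr (j - l) (Fᶜ : Set ℤ) d i‖ * R ^ (i.1 + i.2)) atTop
      (𝓝 (∑' _ : ℕ × ℕ, (0 : ℝ))) := by
    -- Every fixed coefficient drops out once $F$ contains its degree, and the full series
    -- dominates.
    refine tendsto_tsum_of_dominated_convergence (hD R hR hR1) (fun i => ?_)
      (Eventually.of_forall fun F i => ?_)
    · refine tendsto_const_nhds.congr' ?_
      filter_upwards [eventually_ge_atTop {(i.1 : ℤ) - i.2 + (j - l)}] with F hF
      have : (i.1 : ℤ) - i.2 + (j - l) ∈ F := by simpa using hF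
      simp [GenHarm.restr, Set.indicator, this]
    · rw [Real.norm_of_nonneg (by positivity)]
      gcongr
      exact norm_indicator_le_norm_self _ _
  rw [tsum_zero] at hlim
  refine squeeze_zero (fun F => smoothSeminorm_nonneg _ _ _ _) (fun F => ?_) hlim
  refine smoothSeminorm_le j l hKd hR hR1 hKR hn (Fᶜ : Set ℤ) fun z hz => ?_
  rw [← hc.sub_dblSum F hz]
  rw [hu hz, Finset.sum_congr rfl fun m _ => hf m hz]

/-! ### The root condition -/

theorem summable_pow_natAbs {q : ℝ} (h0 : 0 ≤ q) (h1 : q < 1) :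
    Summable fun m : ℤ => q ^ m.natAbs := by
  refine summable_int_iff_summable_nat_and_neg.2 ⟨?_, ?_⟩ <;>
  simpa using summable_geometric_of_lt_one h0 h1

theorem comap_abs_int_eq_cofinite : comap (fun m : ℤ => |m|) atTop = cofinite := by
  rw [Int.cofinite_eq]; exact comap_abs_atTop

theorem enorm_rpow_inv_le_iff {a : ℂ} {R : ℝ} (hR : 0 < R) {n : ℕ} (hn : n ≠ 0) :
    ‖a‖ₑ ^ (1 / (n : ℝ)) ≤ ENNReal.ofReal R⁻¹ ↔ ‖a‖ * R ^ n ≤ 1 := by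
  have hn' : (0 : ℝ) < n := by positivity
  rw [one_div, ENNReal.rpow_inv_le_iff hn', ENNReal.rpow_natCast,
    ← ENNReal.ofReal_pow (by positivity), ← ofReal_norm,
    ENNReal.ofReal_le_ofReal_iff (by positivity), inv_pow, ← one_div,
    le_div_iff₀ (by positivity)]

theorem RootCondition.summable {k : ℤ → ℂ} (hk : RootCondition k) {R : ℝ} (hR : 0 < R)
    (hR1 : R < 1) : Summable fun m : ℤ => ‖k m‖ * R ^ m.natAbs := by
  -- The root condition bounds $|k_m|S^{|m|}$ for almost all $m$; the gap between $R$ and $S$ leaves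
  -- a geometric series of ratio $R/S$.
  obtain ⟨S, hRS, hS1⟩ := exists_between hR1
  have hS : 0 < S := hR.trans hRS
  rw [RootCondition, comap_abs_int_eq_cofinite] at hk
  have h1 : (1 : ℝ≥0∞) < ENNReal.ofReal S⁻¹ := by
    rw [← ENNReal.ofReal_one]
    exact (ENNReal.ofReal_lt_ofReal_iff (by positivity)).2 ((one_lt_inv₀ hS).2 hS1)
  have hev := eventually_lt_of_limsup_lt (hk.trans_lt h1)
  refine Summable.of_norm_bounded_eventually
    (summable_pow_natAbs (q := R / S) (by positivity) ((div_lt_one hS).2 hRS)) ?_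
  -- At $m=0$ the exponent `1 / 0` takes the default value `0`, so this index must be discarded.
  filter_upwards [hev, (Set.finite_singleton (0 : ℤ)).compl_mem_cofinite] with m hm hm0
  have h := (enorm_rpow_inv_le_iff hS (Int.natAbs_ne_zero.2 (by simpa using hm0))).1 hm.le
  rw [Real.norm_of_nonneg (by positivity), div_pow, le_div_iff₀ (by positivity)]
  calc ‖k m‖ * R ^ m.natAbs * S ^ m.natAbs = ‖k m‖ * S ^ m.natAbs * R ^ m.natAbs := by ring
    _ ≤ 1 * R ^ m.natAbs := by gcongr
    _ = _ := one_mul _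

/-- Boundedness at a radius $S>R$ makes $|k_m|R^{|m|}$ tend to zero, so the upper limit is at most
$1/R$; then $R\to1$ from below. -/
theorem rootCondition_of_bounded {k : ℤ → ℂ}
    (h : ∀ R : ℝ, 0 < R → R < 1 → ∃ C : ℝ, ∀ᶠ m in cofinite, ‖k m‖ * R ^ m.natAbs ≤ C) :
    RootCondition k := by
  rw [RootCondition, comap_abs_int_eq_cofinite]
  have main : ∀ R : ℝ, 0 < R → R < 1 →
      limsup (fun m : ℤ => ‖k m‖ₑ ^ (1 / (m.natAbs : ℝ))) cofinite ≤ ENNReal.ofReal R⁻¹ := by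
    intro R hR hR1
    obtain ⟨S, hRS, hS1⟩ := exists_between hR1
    have hS : 0 < S := hR.trans hRS
    obtain ⟨C, hC⟩ := h S hS hS1
    have ht := (summable_pow_natAbs (q := R / S) (by positivity)
      ((div_lt_one hS).2 hRS)).tendsto_cofinite_zero.const_mul C
    rw [mul_zero] at ht
    refine limsup_le_of_le (by isBoundedDefault) ?_
    filter_upwards [hC, ht.eventually_le_const one_pos,
      (Set.finite_singleton (0 : ℤ)).compl_mem_cofinite] with m hm hm1 hm0
    refine (enorm_rpow_inv_le_iff hR (Int.natAbs_ne_zero.2 (by simpa using hm0))).2 ?_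
    calc ‖k m‖ * R ^ m.natAbs = ‖k m‖ * S ^ m.natAbs * (R / S) ^ m.natAbs := by
          rw [div_pow]; field_simp
      _ ≤ C * (R / S) ^ m.natAbs := by gcongr
      _ ≤ 1 := hm1
  have hlim : Tendsto (fun R : ℝ => ENNReal.ofReal R⁻¹) (𝓝[<] 1) (𝓝 1) := by
    have : Tendsto (fun R : ℝ => ENNReal.ofReal R⁻¹) (𝓝 1) (𝓝 (ENNReal.ofReal 1⁻¹)) :=
      ENNReal.tendsto_ofReal (tendsto_inv₀ one_ne_zero)
    simpa using this.mono_left nhdsWithin_le_nhds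
  refine ge_of_tendsto hlim ?_
  filter_upwards [Ioo_mem_nhdsLT (zero_lt_one (α := ℝ))] with R hR using main R hR.1 hR.2

/-! ### The coefficients of the expansion -/

/-- The coefficients of `𝒫(r + s m, s + t | m + 1; ·)`. -/
def hypCoeff (s t r : ℂ) (m n : ℕ) : ℂ :=
  poch (r + s * m) (s + t) n / poch (m + 1) 1 n / n.factorial

/-- The coefficient of `z^p z̄^q` in `term s t r 1 (p - q)`. -/
def baseCoeff (s t r : ℂ) (i : ℕ × ℕ) : ℂ :=
  if i.2 ≤ i.1 then hypCoeff s t r (i.1 - i.2) i.2 else hypCoeff t s r (i.2 - i.1) i.1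

/-- The coefficient of `z^p z̄^q` in the expansion. -/
def expCoeff (s t r : ℂ) (k : ℤ → ℂ) (i : ℕ × ℕ) : ℂ :=
  k (i.1 - i.2) * baseCoeff s t r i

theorem poch_succ (x y : ℂ) (n : ℕ) : poch x y (n + 1) = poch x y n * (x + n * y) := by
  rw [poch, Finset.prod_range_succ, poch]

/-- The numerator gains $r+sm+n(s+t)=s(m+n)+tn+r$. With $p=m+n$ and $q=n$ this is the recurrence
imposed by the equation on $c_{p,q}$. -/
theorem hypCoeff_succ (s t r : ℂ) (m n : ℕ) :
    ((m + n + 1 : ℕ) : ℂ) * ((n + 1 : ℕ) : ℂ) * hypCoeff s t r m (n + 1) =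
      (s * (m + n : ℕ) + t * n + r) * hypCoeff s t r m n := by
  have h1 : ((m + n + 1 : ℕ) : ℂ) ≠ 0 := Nat.cast_ne_zero.2 (by omega)
  have h2 : ((n + 1 : ℕ) : ℂ) ≠ 0 := Nat.cast_ne_zero.2 (by omega)
  have h3 : (m : ℂ) + 1 + n * 1 = ((m + n + 1 : ℕ) : ℂ) := by push_cast; ring
  rw [hypCoeff, hypCoeff, poch_succ, poch_succ, h3, Nat.factorial_succ, Nat.cast_mul]
  rw [div_div, div_div, mul_div_assoc', mul_div_assoc']
  rw [show poch (↑m + 1) 1 n * ((m + n + 1 : ℕ) : ℂ) * (((n + 1 : ℕ) : ℂ) * (n.factorial : ℂ)) =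
    ((m + n + 1 : ℕ) : ℂ) * ((n + 1 : ℕ) : ℂ) * (poch (↑m + 1) 1 n * (n.factorial : ℂ)) by ring,
    mul_div_mul_left _ _ (mul_ne_zero h1 h2)]
  congr 1
  push_cast
  ring

/-- The numerator $s(m+n)+tn+r$ is at most $(|s|+|t|+|r|)(m+n+1)$, and $m+n+1$ cancels in the
recurrence. Independence of $m$ is what matters: it serves both summability and the limit
$m\to\infty$. -/
theorem norm_hypCoeff_le (s t r : ℂ) (m n : ℕ) :
    ‖hypCoeff s t r m n‖ ≤ (‖s‖ + ‖t‖ + ‖r‖) ^ n / n.factorial := by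
  induction n with
  | zero => simp [hypCoeff, poch]
  | succ n ih =>
    have h := congrArg norm (hypCoeff_succ s t r m n)
    rw [norm_mul, norm_mul, norm_mul, Complex.norm_natCast, Complex.norm_natCast] at h
    have hL : ‖s * (m + n : ℕ) + t * n + r‖ ≤ (‖s‖ + ‖t‖ + ‖r‖) * (m + n + 1 : ℕ) := by
      refine (norm_add₃_le).trans ?_
      rw [norm_mul, norm_mul, Complex.norm_natCast, Complex.norm_natCast]
      push_cast
      have := norm_nonneg s; have := norm_nonneg t; have := norm_nonneg r
      have hm : (0 : ℝ) ≤ m := by positivity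
      have hn : (0 : ℝ) ≤ n := by positivity
      nlinarith [mul_nonneg ‹0 ≤ ‖t‖› hm, mul_nonneg ‹0 ≤ ‖r‖› hm, mul_nonneg ‹0 ≤ ‖r‖› hn]
    have hpos : (0 : ℝ) < (m + n + 1 : ℕ) := by positivity
    have hpos' : (0 : ℝ) < (n + 1 : ℕ) := by positivity
    rw [Nat.factorial_succ, Nat.cast_mul, le_div_iff₀ (by positivity)]
    rw [le_div_iff₀ (by positivity)] at ih
    refine le_of_mul_le_mul_left ?_ hpos
    calc ((m + n + 1 : ℕ) : ℝ) * (‖hypCoeff s t r m (n + 1)‖ * ((n + 1 : ℕ) * n.factorial))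
        = ((m + n + 1 : ℕ) * (n + 1 : ℕ) * ‖hypCoeff s t r m (n + 1)‖) * n.factorial := by ring
      _ = ‖s * (m + n : ℕ) + t * n + r‖ * (‖hypCoeff s t r m n‖ * n.factorial) := by
        rw [h]; ring
      _ ≤ ((‖s‖ + ‖t‖ + ‖r‖) * (m + n + 1 : ℕ)) * (‖s‖ + ‖t‖ + ‖r‖) ^ n := by gcongr
      _ = _ := by ring

theorem norm_baseCoeff_le (s t r : ℂ) (i : ℕ × ℕ) :
    ‖baseCoeff s t r i‖ ≤ (‖s‖ + ‖t‖ + ‖r‖) ^ (min i.1 i.2) / (min i.1 i.2).factorial := by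
  rw [baseCoeff]
  split_ifs with h
  · rw [min_eq_right h]; exact norm_hypCoeff_le _ _ _ _ _
  · rw [min_eq_left (by omega), add_comm ‖s‖]; exact norm_hypCoeff_le _ _ _ _ _

/-- These coordinates dominate the double series by a product of two single series:
$\sum|k_m|R^{|m|}$ and an exponential series. -/
theorem injective_sub_min :
    Function.Injective fun i : ℕ × ℕ => ((i.1 : ℤ) - i.2, min i.1 i.2) := by
  rintro ⟨a, b⟩ ⟨a', b'⟩ h
  simp only [Prod.mk.injEq] at h ⊢
  omega

theorem RootCondition.discSummable (s t r : ℂ) {k : ℤ → ℂ} (hk : RootCondition k) :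
    DiscSummable (expCoeff s t r k) := by
  intro R hR hR1
  have h2 := Real.summable_pow_div_factorial (‖s‖ + ‖t‖ + ‖r‖)
  have h := ((hk.summable hR hR1).mul_of_nonneg h2 (fun _ => by positivity)
    (fun _ => by positivity)).comp_injective injective_sub_min
  refine h.of_nonneg_of_le (fun i => by positivity) fun i => ?_
  simp only [Function.comp]
  have hp : R ^ (i.1 + i.2) ≤ R ^ ((i.1 : ℤ) - i.2).natAbs :=
    pow_le_pow_of_le_one hR.le hR1.le (by omega)
  rw [expCoeff, norm_mul]
  calc _ ≤ ‖k (i.1 - i.2)‖ * ((‖s‖ + ‖t‖ + ‖r‖) ^ (min i.1 i.2) / (min i.1 i.2).factorial)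
        * R ^ ((i.1 : ℤ) - i.2).natAbs := by gcongr; exact norm_baseCoeff_le _ _ _ _
    _ = _ := by ring

theorem baseCoeff_succ (s t r : ℂ) (p q : ℕ) :
    ((p + 1 : ℕ) : ℂ) * ((q + 1 : ℕ) : ℂ) * baseCoeff s t r (p + 1, q + 1) =
      (s * p + t * q + r) * baseCoeff s t r (p, q) := by
  simp only [baseCoeff, add_le_add_iff_right, Nat.add_sub_add_right]
  split_ifs with h
  · obtain ⟨m, rfl⟩ := Nat.exists_eq_add_of_le' h
    simpa using hypCoeff_succ s t r m q
  · obtain ⟨m, rfl⟩ := Nat.exists_eq_add_of_le' (not_le.1 h).le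
    have := hypCoeff_succ t s r m p
    rw [Nat.add_sub_cancel]
    linear_combination this

theorem expCoeff_succ (s t r : ℂ) (k : ℤ → ℂ) (p q : ℕ) :
    ((p + 1 : ℕ) : ℂ) * ((q + 1 : ℕ) : ℂ) * expCoeff s t r k (p + 1, q + 1) =
      (s * p + t * q + r) * expCoeff s t r k (p, q) := by
  have h := baseCoeff_succ s t r p q
  simp only [expCoeff]
  rw [show ((p + 1 : ℕ) : ℤ) - (q + 1 : ℕ) = p - q by push_cast; ring]
  linear_combination k (p - q) * h

/-! ### Double series solving the equation -/

theorem mul_dblSum_coeffDz (c : ℕ × ℕ → ℂ) (z : ℂ) :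
    z * dblSum (coeffDz c) z = dblSum (fun i => i.1 * c i) z := by
  rw [tsum_coeffDz, dblSum, ← tsum_mul_left]
  refine tsum_congr fun ⟨p, q⟩ => ?_
  rcases p with _ | p
  · simp
  · simp [pow_succ]; ring

theorem conj_mul_dblSum_coeffDbar (c : ℕ × ℕ → ℂ) (z : ℂ) :
    starRingEnd ℂ z * dblSum (coeffDbar c) z = dblSum (fun i => i.2 * c i) z := by
  rw [tsum_coeffDbar, dblSum, ← tsum_mul_left]
  refine tsum_congr fun ⟨p, q⟩ => ?_
  rcases q with _ | q
  · simp
  · simp [pow_succ]; ring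

theorem DiscSummable.degree_mul {c : ℕ × ℕ → ℂ} (hc : DiscSummable c) :
    DiscSummable fun i => ((i.1 + i.2 : ℕ) : ℂ) * c i := by
  intro R hR hR1
  refine (hc.summable_deriv hR hR1).of_nonneg_of_le (fun i => by positivity) fun i => ?_
  rw [norm_mul, Complex.norm_natCast, mul_comm _ ‖c i‖, mul_assoc]
  have : R ^ (i.1 + i.2) ≤ R ^ (i.1 + i.2 - 1) :=
    pow_le_pow_of_le_one hR.le hR1.le (by omega)
  gcongr

/-- Since $z\partial$ and $\bar z\bar\partial$ multiply $c_{p,q}$ by $p$ and $q$, the hypothesis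
says that each coefficient of the resulting series is zero. -/
theorem DiscSummable.opM_eq_zero {s t r : ℂ} {c : ℕ × ℕ → ℂ} (hc : DiscSummable c)
    (h : ∀ p q : ℕ, ((p + 1 : ℕ) : ℂ) * ((q + 1 : ℕ) : ℂ) * c (p + 1, q + 1) =
      (s * p + t * q + r) * c (p, q)) {z : ℂ} (hz : z ∈ disc) :
    opM s t r (dblSum c) z = 0 := by
  have hd1 : DiscSummable fun i => (i.1 : ℂ) * c i := hc.degree_mul.mono fun i => by
    rw [norm_mul, norm_mul, Complex.norm_natCast, Complex.norm_natCast]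
    gcongr; omega
  have hd2 : DiscSummable fun i => (i.2 : ℂ) * c i := hc.degree_mul.mono fun i => by
    rw [norm_mul, norm_mul, Complex.norm_natCast, Complex.norm_natCast]
    gcongr; omega
  rw [opM, dz_eqOn hc.dbar_dblSum hz, hc.coeffDbar.dz_dblSum hz, hc.dz_dblSum hz,
    hc.dbar_dblSum hz, mul_assoc s, mul_assoc t, mul_dblSum_coeffDz, conj_mul_dblSum_coeffDbar]
  have hs := (((hc.coeffDbar.coeffDz.hasSum hz).sub ((hd1.hasSum hz).mul_left s)).sub
    ((hd2.hasSum hz).mul_left t)).sub ((hc.hasSum hz).mul_left r)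
  refine hs.unique ?_
  refine hasSum_zero.congr_fun fun i => ?_
  have := h i.1 i.2
  simp only [GenHarm.coeffDz, GenHarm.coeffDbar]
  linear_combination (z ^ i.1 * starRingEnd ℂ z ^ i.2) * this

/-! ### The terms of the expansion -/

theorem calP_eq (s t r : ℂ) (m : ℕ) (x : ℂ) :
    calP (r + s * m) (s + t) (m + 1) x = ∑' n : ℕ, hypCoeff s t r m n * x ^ n :=
  tsum_congr fun n => by rw [hypCoeff]; ring

theorem norm_sq_eq_mul_conj (z : ℂ) : (‖z‖ : ℂ) ^ 2 = z * starRingEnd ℂ z := by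
  rw [Complex.mul_conj, Complex.normSq_eq_norm_sq]; push_cast; rfl

theorem dblSum_restr_natCast (s t r : ℂ) (k : ℤ → ℂ) (m : ℕ) (z : ℂ) :
    dblSum (restr 0 {(m : ℤ)} (expCoeff s t r k)) z =
      k m * calP (r + s * m) (s + t) (m + 1) ((‖z‖ : ℂ) ^ 2) * z ^ m := by
  have hinj : Function.Injective fun n : ℕ => (m + n, n) := fun a b h => (Prod.mk.inj h).2
  rw [dblSum, ← hinj.tsum_eq, calP_eq, ← tsum_mul_left, ← tsum_mul_right]
  · refine tsum_congr fun n => ?_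
    rw [norm_sq_eq_mul_conj]
    simp [restr_singleton, expCoeff, baseCoeff, mul_pow, pow_add]
    ring
  · rintro ⟨p, q⟩ h
    have : (p : ℤ) - q = m := by
      by_contra hne
      exact h (by simp [restr_singleton, hne])
    exact ⟨q, by ext <;> simp; omega⟩

theorem dblSum_restr_neg (s t r : ℂ) (k : ℤ → ℂ) {m : ℕ} (hm : 1 ≤ m) (z : ℂ) :
    dblSum (restr 0 {-(m : ℤ)} (expCoeff s t r k)) z =
      k (-m) * calP (r + t * m) (t + s) (m + 1) ((‖z‖ : ℂ) ^ 2) * starRingEnd ℂ z ^ m := by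
  have hinj : Function.Injective fun n : ℕ => (n, m + n) := fun a b h => (Prod.mk.inj h).1
  rw [dblSum, ← hinj.tsum_eq, calP_eq, ← tsum_mul_left, ← tsum_mul_right]
  · refine tsum_congr fun n => ?_
    rw [norm_sq_eq_mul_conj]
    have hm0 : m ≠ 0 := by omega
    simp [restr_singleton, expCoeff, baseCoeff, mul_pow, pow_add, hm0]
    ring
  · rintro ⟨p, q⟩ h
    have : (p : ℤ) - q = -m := by
      by_contra hne
      exact h (by simp [restr_singleton, hne])
    exact ⟨p, by ext <;> simp; omega⟩

theorem term_natCast (s t r : ℂ) (k : ℤ → ℂ) (m : ℕ) (z : ℂ) :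
    term s t r k m z =
      k m * calP (r + s * m) (s + t) (m + 1) ((‖z‖ : ℂ) ^ 2) * z ^ m := by
  simp [term]

theorem term_neg (s t r : ℂ) (k : ℤ → ℂ) {m : ℕ} (hm : 1 ≤ m) (z : ℂ) :
    term s t r k (-m) z =
      k (-m) * calP (r + t * m) (t + s) (m + 1) ((‖z‖ : ℂ) ^ 2) * starRingEnd ℂ z ^ m := by
  have : ¬ (0 : ℤ) ≤ -(m : ℤ) := by omega
  rw [term, if_neg this]
  simp

/-- Because $|z|^2=z\bar z$, expanding $\mathcal P$ lists exactly the monomials on the diagonal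
$p-q=m$. -/
theorem term_eq_dblSum (s t r : ℂ) (k : ℤ → ℂ) (m : ℤ) (z : ℂ) :
    term s t r k m z = dblSum (restr 0 {m} (expCoeff s t r k)) z := by
  rcases le_or_gt 0 m with h | h
  · obtain ⟨n, rfl⟩ := Int.eq_ofNat_of_zero_le h
    rw [term_natCast, dblSum_restr_natCast]
  · obtain ⟨n, hn⟩ := Int.eq_ofNat_of_zero_le (a := -m) (by omega)
    obtain rfl : m = -(n : ℤ) := by omega
    rw [term_neg _ _ _ _ (by omega), dblSum_restr_neg _ _ _ _ (by omega)]

theorem RootCondition.hasSum_term (s t r : ℂ) {k : ℤ → ℂ} (hk : RootCondition k) {z : ℂ}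
    (hz : z ∈ disc) :
    HasSum (fun m => term s t r k m z) (dblSum (expCoeff s t r k) z) :=
  ((hk.discSummable s t r).hasSum_restr hz).congr_fun fun _ => term_eq_dblSum _ _ _ _ _ _

theorem hasSum_int_of_nat_of_pos {f : ℤ → ℂ} {a b : ℂ} (ha : HasSum (fun m : ℕ => f m) a)
    (hb : HasSum (fun m : {m : ℕ // 1 ≤ m} => f (-((m : ℕ) : ℤ))) b) : HasSum f (a + b) := by
  let e : ℕ ≃ {m : ℕ // 1 ≤ m} :=
    ⟨fun n => ⟨n + 1, by omega⟩, fun m => m.1 - 1, fun n => by simp,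
      fun m => Subtype.ext (by have := m.2; simp; omega)⟩
  refine ha.of_nat_of_neg_add_one ?_
  refine ((e.hasSum_iff).2 hb).congr_fun fun n => ?_
  simp [e]

theorem RootCondition.isSolution (s t r : ℂ) {k : ℤ → ℂ} (hk : RootCondition k) {u : ℂ → ℂ}
    (hu : Set.EqOn u (dblSum (expCoeff s t r k)) disc) : IsSolution s t r u := by
  have hc := hk.discSummable s t r
  refine ⟨(hc.contDiffOn_nat 2).congr hu, fun z hz => ?_⟩
  rw [opM_eqOn s t r hu hz]
  exact hc.opM_eq_zero (expCoeff_succ s t r k) hz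

/-! ### Fourier coefficients on circles -/

/-- The `m`-th Fourier coefficient of `θ ↦ f (x e^{iθ})`. -/
def circMean (m : ℤ) (f : ℂ → ℂ) (x : ℝ) : ℂ :=
  (1 / (2 * Real.pi) : ℂ) * ∫ θ in (0 : ℝ)..2 * Real.pi,
    f (x * Complex.exp (θ * Complex.I)) * Complex.exp (-(m * θ * Complex.I))

theorem norm_circle (x θ : ℝ) : ‖(x : ℂ) * Complex.exp (θ * Complex.I)‖ = |x| := by
  simp [Complex.norm_exp_ofReal_mul_I]

theorem circle_mem_disc {x : ℝ} (hx : |x| < 1) (θ : ℝ) :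
    (x : ℂ) * Complex.exp (θ * Complex.I) ∈ disc := by
  rwa [mem_disc, norm_circle]

theorem norm_exp_neg_int_mul (m : ℤ) (θ : ℝ) :
    ‖Complex.exp (-(m * θ * Complex.I))‖ = 1 := by
  rw [show -((m : ℂ) * θ * Complex.I) = ((-(m * θ) : ℝ) : ℂ) * Complex.I by push_cast; ring]
  exact Complex.norm_exp_ofReal_mul_I _

theorem exp_mul_exp_neg (m : ℤ) (θ : ℝ) :
    Complex.exp (θ * Complex.I) * Complex.exp (-(m * θ * Complex.I)) =
      Complex.exp (-((m - 1 : ℤ) * θ * Complex.I)) := by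
  rw [← Complex.exp_add]; congr 1; push_cast; ring

theorem conj_exp_mul_I (θ : ℝ) :
    starRingEnd ℂ (Complex.exp (θ * Complex.I)) = Complex.exp (-(θ * Complex.I)) := by
  rw [← Complex.exp_conj]; simp

theorem conj_exp_mul_exp_neg (m : ℤ) (θ : ℝ) :
    starRingEnd ℂ (Complex.exp (θ * Complex.I)) * Complex.exp (-(m * θ * Complex.I)) =
      Complex.exp (-((m + 1 : ℤ) * θ * Complex.I)) := by
  rw [conj_exp_mul_I, ← Complex.exp_add]; congr 1; push_cast; ring

theorem continuous_circle {f : ℂ → ℂ} (hf : ContinuousOn f disc) {x : ℝ} (hx : |x| < 1) :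
    Continuous fun θ : ℝ => f (x * Complex.exp (θ * Complex.I)) :=
  hf.comp_continuous (by fun_prop) (circle_mem_disc hx)

theorem continuous_circMean_integrand (m : ℤ) {f : ℂ → ℂ} (hf : ContinuousOn f disc) {x : ℝ}
    (hx : |x| < 1) :
    Continuous fun θ : ℝ =>
      f (x * Complex.exp (θ * Complex.I)) * Complex.exp (-(m * θ * Complex.I)) :=
  (continuous_circle hf hx).mul (by fun_prop)

theorem norm_circMean_le (m : ℤ) {f : ℂ → ℂ} {x C : ℝ}
    (h : ∀ z : ℂ, ‖z‖ = |x| → ‖f z‖ ≤ C) : ‖circMean m f x‖ ≤ C := by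
  have h1 : ‖∫ θ in (0 : ℝ)..2 * Real.pi,
      f (x * Complex.exp (θ * Complex.I)) * Complex.exp (-(m * θ * Complex.I))‖
      ≤ C * |2 * Real.pi - 0| :=
    intervalIntegral.norm_integral_le_of_norm_le_const fun θ _ => by
      rw [norm_mul, norm_exp_neg_int_mul, mul_one]
      exact h _ (norm_circle x θ)
  have hpi := Real.pi_pos
  rw [sub_zero, abs_of_pos (by positivity)] at h1
  have h2 : ‖(1 / (2 * Real.pi) : ℂ)‖ = 1 / (2 * Real.pi) := by
    rw [show (1 / (2 * Real.pi) : ℂ) = ((1 / (2 * Real.pi) : ℝ) : ℂ) by push_cast; rfl,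
      Complex.norm_of_nonneg (by positivity)]
  rw [circMean, norm_mul, h2, div_mul_eq_mul_div, one_mul, div_le_iff₀ (by positivity)]
  exact h1

theorem contDiffOn_dz {n : ℕ∞ω} {f : ℂ → ℂ} (hf : ContDiffOn ℝ (n + 1) f disc) :
    ContDiffOn ℝ n (dz f) disc := by
  have h := hf.fderiv_of_isOpen isOpen_disc le_rfl
  exact ((h.clm_apply contDiffOn_const).sub
    (contDiffOn_const.mul (h.clm_apply contDiffOn_const))).div_const 2

theorem contDiffOn_dbar {n : ℕ∞ω} {f : ℂ → ℂ} (hf : ContDiffOn ℝ (n + 1) f disc) :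
    ContDiffOn ℝ n (dbar f) disc := by
  have h := hf.fderiv_of_isOpen isOpen_disc le_rfl
  exact ((h.clm_apply contDiffOn_const).add
    (contDiffOn_const.mul (h.clm_apply contDiffOn_const))).div_const 2

theorem continuousOn_dz {f : ℂ → ℂ} (hf : ContDiffOn ℝ 1 f disc) : ContinuousOn (dz f) disc :=
  (contDiffOn_dz (n := 0) (by simpa using hf)).continuousOn

theorem continuousOn_dbar {f : ℂ → ℂ} (hf : ContDiffOn ℝ 1 f disc) :
    ContinuousOn (dbar f) disc :=
  (contDiffOn_dbar (n := 0) (by simpa using hf)).continuousOn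

theorem hasFDerivAt_of_contDiffOn {f : ℂ → ℂ} (hf : ContDiffOn ℝ 1 f disc) {z : ℂ}
    (hz : z ∈ disc) : HasFDerivAt f (wirtinger (dz f z) (dbar f z)) z := by
  rw [← fderiv_eq_wirtinger]
  exact ((hf.contDiffAt (isOpen_disc.mem_nhds hz)).differentiableAt one_ne_zero).hasFDerivAt

theorem exists_bound_closedBall {f : ℂ → ℂ} (hf : ContinuousOn f disc) {R : ℝ} (hR1 : R < 1) :
    ∃ C : ℝ, ∀ z : ℂ, ‖z‖ ≤ R → ‖f z‖ ≤ C := by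
  have hsub : Metric.closedBall (0 : ℂ) R ⊆ disc := Metric.closedBall_subset_ball hR1
  obtain ⟨C, hC⟩ := (isCompact_closedBall (0 : ℂ) R).exists_bound_of_continuousOn (hf.mono hsub)
  exact ⟨C, fun z hz => hC z (by simpa using hz)⟩

theorem circMean_combination (m : ℤ) {f g : ℂ → ℂ} (hf : ContinuousOn f disc)
    (hg : ContinuousOn g disc) {x : ℝ} (hx : |x| < 1) (a b : ℂ) :
    a * circMean (m - 1) f x + b * circMean (m + 1) g x =
      (1 / (2 * Real.pi) : ℂ) * ∫ θ in (0 : ℝ)..2 * Real.pi,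
        (a * (f (x * Complex.exp (θ * Complex.I)) * Complex.exp (θ * Complex.I)) +
          b * (g (x * Complex.exp (θ * Complex.I)) *
            starRingEnd ℂ (Complex.exp (θ * Complex.I)))) *
          Complex.exp (-(m * θ * Complex.I)) := by
  have h1 := ((continuous_circMean_integrand (m - 1) hf hx).const_mul a).intervalIntegrable
    (μ := MeasureTheory.volume) 0 (2 * Real.pi)
  have h2 := ((continuous_circMean_integrand (m + 1) hg hx).const_mul b).intervalIntegrable
    (μ := MeasureTheory.volume) 0 (2 * Real.pi)
  rw [circMean, circMean, mul_left_comm a, mul_left_comm b, ← mul_add,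
    ← intervalIntegral.integral_const_mul, ← intervalIntegral.integral_const_mul,
    ← intervalIntegral.integral_add h1 h2]
  congr 2
  funext θ
  rw [← exp_mul_exp_neg, ← conj_exp_mul_exp_neg]
  ring

/-- The radial derivative is $e^{i\theta}\partial+e^{-i\theta}\bar\partial$, whose exponentials
shift the Fourier index. Allowing $x\le0$ yields the continuity at $0$ needed for the Wronskian. -/
theorem hasDerivAt_circMean (m : ℤ) {f : ℂ → ℂ} (hf : ContDiffOn ℝ 1 f disc) {x : ℝ}
    (hx : |x| < 1) :
    HasDerivAt (circMean m f)
      (circMean (m - 1) (dz f) x + circMean (m + 1) (dbar f) x) x := by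
  have h1 := continuousOn_dz hf
  have h2 := continuousOn_dbar hf
  obtain ⟨R, hxR, hR1⟩ := exists_between hx
  obtain ⟨C₁, hC₁⟩ := exists_bound_closedBall h1 hR1
  obtain ⟨C₂, hC₂⟩ := exists_bound_closedBall h2 hR1
  have hcomb := circMean_combination m h1 h2 hx 1 1
  rw [one_mul, one_mul] at hcomb
  rw [hcomb]
  refine HasDerivAt.const_mul _ ?_
  refine (intervalIntegral.hasDerivAt_integral_of_dominated_loc_of_deriv_le
    (F := fun (x θ : ℝ) => f (x * Complex.exp (θ * Complex.I)) *
      Complex.exp (-(m * θ * Complex.I)))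
    (F' := fun (x θ : ℝ) =>
      (1 * (dz f (x * Complex.exp (θ * Complex.I)) * Complex.exp (θ * Complex.I)) +
          1 * (dbar f (x * Complex.exp (θ * Complex.I)) *
            starRingEnd ℂ (Complex.exp (θ * Complex.I)))) *
          Complex.exp (-(m * θ * Complex.I)))
    (s := Metric.ball (0 : ℝ) R) (bound := fun _ => C₁ + C₂)
    (Metric.isOpen_ball.mem_nhds (by simpa using hxR)) ?_ ?_ ?_ ?_ ?_ ?_).2
  · filter_upwards [Metric.isOpen_ball.mem_nhds
      (by simpa using hxR : x ∈ Metric.ball (0 : ℝ) R)] with y hy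
    exact (continuous_circMean_integrand m hf.continuousOn
      ((by simpa using hy : |y| < R).trans hR1)).aestronglyMeasurable
  · exact (continuous_circMean_integrand m hf.continuousOn hx).intervalIntegrable _ _
  · refine Continuous.aestronglyMeasurable ?_
    have := continuous_circle h1 hx
    have := continuous_circle h2 hx
    have hconj : Continuous fun θ : ℝ => starRingEnd ℂ (Complex.exp (θ * Complex.I)) :=
      Complex.continuous_conj.comp (by fun_prop)
    fun_prop
  · refine Eventually.of_forall fun θ _ y hy => ?_
    have hy' : ‖(y : ℂ) * Complex.exp (θ * Complex.I)‖ ≤ R := by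
      rw [norm_circle]; exact (by simpa using hy : |y| < R).le
    rw [norm_mul, norm_exp_neg_int_mul, mul_one, one_mul, one_mul]
    refine (norm_add_le _ _).trans (add_le_add ?_ ?_)
    · rw [norm_mul, Complex.norm_exp_ofReal_mul_I, mul_one]; exact hC₁ _ hy'
    · rw [norm_mul, RCLike.norm_conj, Complex.norm_exp_ofReal_mul_I, mul_one]; exact hC₂ _ hy'
  · exact intervalIntegrable_const
  · refine Eventually.of_forall fun θ _ y hy => ?_
    have hy' : |y| < 1 := (by simpa using hy : |y| < R).trans hR1
    refine HasDerivAt.mul_const ?_ _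
    have hl : HasDerivAt (fun y : ℝ => (y : ℂ) * Complex.exp (θ * Complex.I))
        (1 * Complex.exp (θ * Complex.I)) y :=
      (Complex.ofRealCLM.hasDerivAt (x := y)).mul_const _
    have := (hasFDerivAt_of_contDiffOn hf (circle_mem_disc hy' θ)).comp_hasDerivAt y hl
    simpa [Function.comp_def] using this

/-- The angular derivative of $f$ is $i(z\partial-\bar z\bar\partial)f$, and a periodic integrand
has no boundary terms. -/
theorem circMean_integration_by_parts (m : ℤ) {f : ℂ → ℂ} (hf : ContDiffOn ℝ 1 f disc) {x : ℝ}
    (hx : |x| < 1) :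
    x * circMean (m - 1) (dz f) x - x * circMean (m + 1) (dbar f) x = m * circMean m f x := by
  have h1 := continuousOn_dz hf
  have h2 := continuousOn_dbar hf
  have hcomb := circMean_combination m h1 h2 hx (x * Complex.I) (-(x * Complex.I))
  have hderiv : ∀ θ : ℝ, HasDerivAt
      (fun θ : ℝ => f (x * Complex.exp (θ * Complex.I)) * Complex.exp (-(m * θ * Complex.I)))
      (((x * Complex.I) * (dz f (x * Complex.exp (θ * Complex.I)) * Complex.exp (θ * Complex.I)) +
          (-(x * Complex.I)) * (dbar f (x * Complex.exp (θ * Complex.I)) *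
            starRingEnd ℂ (Complex.exp (θ * Complex.I)))) *
          Complex.exp (-(m * θ * Complex.I)) - (m * Complex.I) *
        (f (x * Complex.exp (θ * Complex.I)) * Complex.exp (-(m * θ * Complex.I)))) θ := by
    intro θ
    have hid : HasDerivAt (fun θ : ℝ => (θ : ℂ)) 1 θ := Complex.ofRealCLM.hasDerivAt
    have hl : HasDerivAt (fun θ : ℝ => (x : ℂ) * Complex.exp (θ * Complex.I))
        (x * (Complex.exp (θ * Complex.I) * (1 * Complex.I))) θ :=
      ((hid.mul_const Complex.I).cexp).const_mul _
    have hr : HasDerivAt (fun θ : ℝ => Complex.exp (-(m * θ * Complex.I)))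
        (Complex.exp (-(m * θ * Complex.I)) * (-(m * 1 * Complex.I))) θ :=
      (((hid.const_mul (m : ℂ)).mul_const Complex.I).neg).cexp
    have hc := (hasFDerivAt_of_contDiffOn hf (circle_mem_disc hx θ)).comp_hasDerivAt θ hl
    refine (hc.mul hr).congr_deriv ?_
    simp only [wirtinger_apply, map_mul, Complex.conj_ofReal, Complex.conj_I, map_one,
      Function.comp]
    ring
  have hcont1 : Continuous fun θ : ℝ =>
      ((x * Complex.I) * (dz f (x * Complex.exp (θ * Complex.I)) * Complex.exp (θ * Complex.I)) +
          (-(x * Complex.I)) * (dbar f (x * Complex.exp (θ * Complex.I)) *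
            starRingEnd ℂ (Complex.exp (θ * Complex.I)))) *
          Complex.exp (-(m * θ * Complex.I)) := by
    have := continuous_circle h1 hx
    have := continuous_circle h2 hx
    have hconj : Continuous fun θ : ℝ => starRingEnd ℂ (Complex.exp (θ * Complex.I)) :=
      Complex.continuous_conj.comp (by fun_prop)
    fun_prop
  have hcont2 := (continuous_circMean_integrand m hf.continuousOn hx).const_mul (m * Complex.I)
  have hint := intervalIntegral.integral_eq_sub_of_hasDerivAt
    (a := 0) (b := 2 * Real.pi) (fun θ _ => hderiv θ)
    ((hcont1.sub hcont2).intervalIntegrable _ _)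
  rw [intervalIntegral.integral_sub (hcont1.intervalIntegrable _ _)
    (hcont2.intervalIntegrable _ _), intervalIntegral.integral_const_mul] at hint
  have hper : Complex.exp (-(m * ((2 * Real.pi : ℝ) : ℂ) * Complex.I)) = 1 := by
    rw [Complex.exp_eq_one_iff]
    exact ⟨-m, by push_cast; ring⟩
  have hper' : Complex.exp (((2 * Real.pi : ℝ) : ℂ) * Complex.I) = 1 := by
    push_cast; exact Complex.exp_two_pi_mul_I
  rw [hper, hper'] at hint
  simp only [Complex.ofReal_zero, zero_mul, mul_zero, neg_zero, Complex.exp_zero, sub_self]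
    at hint
  have hkey : (x * Complex.I) * circMean (m - 1) (dz f) x +
      (-(x * Complex.I)) * circMean (m + 1) (dbar f) x - m * Complex.I * circMean m f x = 0 := by
    rw [hcomb, circMean]
    linear_combination (1 / (2 * Real.pi) : ℂ) * hint
  have hI := Complex.I_ne_zero
  refine mul_left_cancel₀ hI ?_
  linear_combination hkey

/-! ### The radial system -/

/-- `(G, H)` satisfies at `x` the first-order system of the `m`-th Fourier coefficients of
`(u, ∂̄u)` for a solution `u`. -/
def RadialSystem (s t r : ℂ) (m : ℤ) (G H : ℝ → ℂ) (x : ℝ) : Prop :=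
  HasDerivAt G (m / x * G x + 2 * H x) x ∧
    HasDerivAt H (2 * (s * m + r) * G x + (-(m + 1) / x + 2 * (s + t) * x) * H x) x

theorem IsSolution.contDiffOn_one {s t r : ℂ} {u : ℂ → ℂ} (hu : IsSolution s t r u) :
    ContDiffOn ℝ 1 u disc := hu.1.of_le (by norm_num)

theorem IsSolution.contDiffOn_dbar {s t r : ℂ} {u : ℂ → ℂ} (hu : IsSolution s t r u) :
    ContDiffOn ℝ 1 (dbar u) disc :=
  GenHarm.contDiffOn_dbar (by
    have := hu.1
    rwa [show (2 : ℕ∞ω) = 1 + 1 by norm_num] at this)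

theorem IsSolution.circMean_dz_dbar {s t r : ℂ} {u : ℂ → ℂ} (hu : IsSolution s t r u) (m : ℤ)
    {x : ℝ} (hx : |x| < 1) :
    circMean m (dz (dbar u)) x = s * x * circMean (m - 1) (dz u) x +
      t * x * circMean (m + 1) (dbar u) x + r * circMean m u x := by
  have h1 := continuousOn_dz hu.contDiffOn_one
  have h2 := continuousOn_dbar hu.contDiffOn_one
  have hi : IntervalIntegrable (fun θ : ℝ =>
      (s * x * (dz u (x * Complex.exp (θ * Complex.I)) * Complex.exp (θ * Complex.I)) +
          t * x * (dbar u (x * Complex.exp (θ * Complex.I)) *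
            starRingEnd ℂ (Complex.exp (θ * Complex.I)))) *
          Complex.exp (-(m * θ * Complex.I))) MeasureTheory.volume 0 (2 * Real.pi) := by
    refine Continuous.intervalIntegrable ?_ _ _
    have := continuous_circle h1 hx
    have := continuous_circle h2 hx
    have hconj : Continuous fun θ : ℝ => starRingEnd ℂ (Complex.exp (θ * Complex.I)) :=
      Complex.continuous_conj.comp (by fun_prop)
    fun_prop
  have hi' := ((continuous_circMean_integrand m hu.1.continuousOn hx).const_mul r).intervalIntegrable
    (μ := MeasureTheory.volume) 0 (2 * Real.pi)
  rw [circMean_combination m h1 h2 hx, circMean, circMean, mul_left_comm r, ← mul_add,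
    ← intervalIntegral.integral_const_mul r, ← intervalIntegral.integral_add hi hi']
  congr 2
  funext θ
  have h := hu.2 _ (circle_mem_disc hx θ)
  rw [opM, map_mul, Complex.conj_ofReal] at h
  linear_combination Complex.exp (-(m * θ * Complex.I)) * h

/-- The angular identities for $u$ and $\bar\partial u$ eliminate the means of $\partial u$ and
$\bar\partial^2u$; the equation eliminates that of $\partial\bar\partial u$. A first-order system
only differentiates $u$ and $\bar\partial u$ once, so $C^2$ suffices. -/
theorem IsSolution.radialSystem {s t r : ℂ} {u : ℂ → ℂ} (hu : IsSolution s t r u) (m : ℤ)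
    {x : ℝ} (hx : x ∈ Set.Ioo (0 : ℝ) 1) :
    RadialSystem s t r m (circMean m u) (circMean (m + 1) (dbar u)) x := by
  have hx1 : |x| < 1 := by rw [abs_of_pos hx.1]; exact hx.2
  have hx0 : (x : ℂ) ≠ 0 := Complex.ofReal_ne_zero.2 hx.1.ne'
  have e1 := circMean_integration_by_parts m hu.contDiffOn_one hx1
  have e2 := circMean_integration_by_parts (m + 1) hu.contDiffOn_dbar hx1
  have e3 := hu.circMean_dz_dbar m hx1
  have d2 := hasDerivAt_circMean (m + 1) hu.contDiffOn_dbar hx1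
  rw [add_sub_cancel_right] at e2 d2
  refine ⟨(hasDerivAt_circMean m hu.contDiffOn_one hx1).congr_deriv ?_, d2.congr_deriv ?_⟩
  · field_simp
    linear_combination e1
  · push_cast at e2
    field_simp
    linear_combination (2 * x) * e3 - e2 + 2 * x * s * e1

/-! ### One-dimensionality of the regular solutions of the radial system -/

theorem linear_system_unique {a b c d : ℝ → ℂ} {M l h x₀ : ℝ} (hx₀ : x₀ ∈ Set.Ioo l h)
    (hM : ∀ x ∈ Set.Ioo l h, ‖a x‖ ≤ M ∧ ‖b x‖ ≤ M ∧ ‖c x‖ ≤ M ∧ ‖d x‖ ≤ M)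
    {G₁ H₁ G₂ H₂ : ℝ → ℂ}
    (h₁ : ∀ x ∈ Set.Ioo l h, HasDerivAt G₁ (a x * G₁ x + b x * H₁ x) x ∧
      HasDerivAt H₁ (c x * G₁ x + d x * H₁ x) x)
    (h₂ : ∀ x ∈ Set.Ioo l h, HasDerivAt G₂ (a x * G₂ x + b x * H₂ x) x ∧
      HasDerivAt H₂ (c x * G₂ x + d x * H₂ x) x)
    (hG : G₁ x₀ = G₂ x₀) (hH : H₁ x₀ = H₂ x₀) : Set.EqOn G₁ G₂ (Set.Ioo l h) := by
  have hM0 : 0 ≤ M := (norm_nonneg _).trans (hM x₀ hx₀).1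
  have key : Set.EqOn (fun x => (G₁ x, H₁ x)) (fun x => (G₂ x, H₂ x)) (Set.Ioo l h) := by
    refine ODE_solution_unique_of_mem_Ioo (s := fun _ => Set.univ) (K := ⟨2 * M, by positivity⟩)
      (v := fun x p => (a x * p.1 + b x * p.2, c x * p.1 + d x * p.2)) (fun x hx => ?_) hx₀
      (fun x hx => ⟨(h₁ x hx).1.prodMk (h₁ x hx).2, trivial⟩)
      (fun x hx => ⟨(h₂ x hx).1.prodMk (h₂ x hx).2, trivial⟩) (Prod.ext hG hH)
    obtain ⟨ha, hb, hc, hd⟩ := hM x hx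
    refine (LipschitzWith.of_dist_le_mul fun p q => ?_).lipschitzOnWith
    have bound : ∀ α β : ℂ, ‖α‖ ≤ M → ‖β‖ ≤ M →
        dist (α * p.1 + β * p.2) (α * q.1 + β * q.2) ≤ 2 * M * dist p q := by
      intro α β hα hβ
      have e1 : ‖p.1 - q.1‖ ≤ dist p q := by
        rw [← dist_eq_norm]; exact le_max_left _ _
      have e2 : ‖p.2 - q.2‖ ≤ dist p q := by
        rw [← dist_eq_norm]; exact le_max_right _ _
      rw [dist_eq_norm, show α * p.1 + β * p.2 - (α * q.1 + β * q.2) =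
        α * (p.1 - q.1) + β * (p.2 - q.2) by ring]
      calc _ ≤ ‖α‖ * ‖p.1 - q.1‖ + ‖β‖ * ‖p.2 - q.2‖ := by
            simpa only [norm_mul] using norm_add_le (α * (p.1 - q.1)) (β * (p.2 - q.2))
        _ ≤ M * dist p q + M * dist p q := by gcongr
        _ = _ := by ring
    exact max_le (bound _ _ ha hb) (bound _ _ hc hd)
  exact fun x hx => congrArg Prod.fst (key hx)

theorem eq_of_hasDerivAt_zero {f : ℝ → ℂ} {a b : ℝ}
    (h : ∀ x ∈ Set.Ioo a b, HasDerivAt f 0 x) {x y : ℝ} (hx : x ∈ Set.Ioo a b)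
    (hy : y ∈ Set.Ioo a b) : f x = f y :=
  isOpen_Ioo.is_const_of_deriv_eq_zero isPreconnected_Ioo
    (fun w hw => (h w hw).differentiableAt.differentiableWithinAt)
    (fun w hw => (h w hw).deriv) hx hy

/-- The trace of the system is $-1/x+2(s+t)x$, so $x\,e^{-(s+t)x^2}$ times the Wronskian is
constant. Its factor $x$ forces the limit $0$ at the origin. -/
theorem RadialSystem.wronskian_eq_zero {s t r : ℂ} {m : ℤ} {G₁ H₁ G₂ H₂ : ℝ → ℂ}
    (h₁ : ∀ x ∈ Set.Ioo (0 : ℝ) 1, RadialSystem s t r m G₁ H₁ x)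
    (h₂ : ∀ x ∈ Set.Ioo (0 : ℝ) 1, RadialSystem s t r m G₂ H₂ x)
    (hG₁ : ContinuousAt G₁ 0) (hH₁ : ContinuousAt H₁ 0)
    (hG₂ : ContinuousAt G₂ 0) (hH₂ : ContinuousAt H₂ 0) {x : ℝ} (hx : x ∈ Set.Ioo (0 : ℝ) 1) :
    G₁ x * H₂ x = H₁ x * G₂ x := by
  set E : ℝ → ℂ := fun x =>
    x * Complex.exp (-((s + t) * x ^ 2)) * (G₁ x * H₂ x - H₁ x * G₂ x) with hE
  have hE' : ∀ y ∈ Set.Ioo (0 : ℝ) 1, HasDerivAt E 0 y := by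
    intro y hy
    have hy0 : (y : ℂ) ≠ 0 := Complex.ofReal_ne_zero.2 hy.1.ne'
    have hid : HasDerivAt (fun y : ℝ => (y : ℂ)) 1 y := Complex.ofRealCLM.hasDerivAt
    have hexp := (((hid.pow 2).const_mul (s + t)).neg).cexp
    have hW := ((h₁ y hy).1.mul (h₂ y hy).2).sub ((h₁ y hy).2.mul (h₂ y hy).1)
    refine ((hid.mul hexp).mul hW).congr_deriv ?_
    simp only [Pi.mul_apply, Pi.sub_apply, Pi.pow_apply, Pi.neg_apply]
    field_simp
    push_cast
    ring
  have hc : ContinuousAt E 0 := by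
    have h1 : ContinuousAt (fun x : ℝ => (x : ℂ) * Complex.exp (-((s + t) * x ^ 2))) 0 := by
      fun_prop
    exact h1.mul ((hG₁.mul hH₂).sub (hH₁.mul hG₂))
  have hlim : Tendsto E (𝓝[>] 0) (𝓝 0) := by
    have := hc.tendsto.mono_left (nhdsWithin_le_nhds (s := Set.Ioi 0))
    simpa [hE] using this
  have hEx : E x = 0 := by
    refine tendsto_nhds_unique (tendsto_const_nhds.congr' ?_) hlim
    filter_upwards [Ioo_mem_nhdsGT (zero_lt_one (α := ℝ))] with y hy
    exact eq_of_hasDerivAt_zero hE' hx hy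
  have hx0 : (x : ℂ) ≠ 0 := Complex.ofReal_ne_zero.2 hx.1.ne'
  simp only [hE, mul_eq_zero, hx0, Complex.exp_ne_zero, false_or] at hEx
  exact sub_eq_zero.1 hEx

theorem RadialSystem.exists_eq_const_mul {s t r : ℂ} {m : ℤ} {G₁ H₁ G₂ H₂ : ℝ → ℂ}
    (h₁ : ∀ x ∈ Set.Ioo (0 : ℝ) 1, RadialSystem s t r m G₁ H₁ x)
    (h₂ : ∀ x ∈ Set.Ioo (0 : ℝ) 1, RadialSystem s t r m G₂ H₂ x)
    (hG₁ : ContinuousAt G₁ 0) (hH₁ : ContinuousAt H₁ 0)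
    (hG₂ : ContinuousAt G₂ 0) (hH₂ : ContinuousAt H₂ 0)
    (hne : ∀ᶠ x in 𝓝[>] (0 : ℝ), G₂ x ≠ 0) :
    ∃ k : ℂ, ∀ x ∈ Set.Ioo (0 : ℝ) 1, G₁ x = k * G₂ x := by
  have hW := fun {x} => RadialSystem.wronskian_eq_zero h₁ h₂ hG₁ hH₁ hG₂ hH₂ (x := x)
  obtain ⟨ε, hε, hsub⟩ := mem_nhdsGT_iff_exists_Ioo_subset.1
    (inter_mem hne (Ioo_mem_nhdsGT (zero_lt_one (α := ℝ))))
  have hε0 : 0 < ε := hε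
  have hx₀ : ε / 2 ∈ Set.Ioo 0 ε := ⟨by linarith, by linarith⟩
  set x₀ := ε / 2
  set k := G₁ x₀ / G₂ x₀ with hk
  have hx₀1 : x₀ ∈ Set.Ioo (0 : ℝ) 1 := (hsub hx₀).2
  have hne₀ : G₂ x₀ ≠ 0 := (hsub hx₀).1
  have hG : G₁ x₀ = k * G₂ x₀ := by rw [hk, div_mul_cancel₀ _ hne₀]
  -- The vanishing Wronskian matches the second components too, giving full initial data at $x_0$.
  -- Uniqueness then covers points where $G_2$ vanishes.
  have hH : H₁ x₀ = k * H₂ x₀ := by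
    refine mul_right_cancel₀ hne₀ ?_
    rw [← hW hx₀1, hG]; ring
  refine ⟨k, fun x hx => ?_⟩
  -- An interval around $x$ and $x_0$ bounded away from $0$ keeps the singular coefficients bounded.
  obtain ⟨l, hl0, hl⟩ := exists_between (lt_min hx.1 hx₀1.1)
  obtain ⟨h, hh, hh1⟩ := exists_between (max_lt hx.2 hx₀1.2)
  have hIoo : ∀ y ∈ Set.Ioo l h, y ∈ Set.Ioo (0 : ℝ) 1 := fun y hy =>
    ⟨hl0.trans hy.1, hy.2.trans hh1⟩
  have hinv : ∀ (α : ℂ), ∀ y ∈ Set.Ioo l h, ‖α / y‖ ≤ ‖α‖ / l := by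
    intro α y hy
    rw [norm_div, Complex.norm_of_nonneg (hIoo y hy).1.le]
    have := hy.1
    gcongr
  refine linear_system_unique (l := l) (h := h) (x₀ := x₀)
    (a := fun y => m / y) (b := fun _ => 2) (c := fun _ => 2 * (s * m + r))
    (d := fun y => -(m + 1) / y + 2 * (s + t) * y)
    (M := max (max (‖(m : ℂ)‖ / l) ‖(2 : ℂ)‖)
      (max ‖2 * (s * m + r)‖ (‖-((m : ℂ) + 1)‖ / l + ‖2 * (s + t)‖)))
    (G₂ := fun x => k * G₂ x) (H₁ := H₁) (H₂ := fun x => k * H₂ x)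
    ⟨hl.trans_le (min_le_right _ _), (le_max_right _ _).trans_lt hh⟩ (fun y hy => ?_)
    (fun y hy => h₁ y (hIoo y hy)) (fun y hy => ?_) hG hH
    ⟨hl.trans_le (min_le_left _ _), (le_max_left _ _).trans_lt hh⟩
  · refine ⟨(hinv m y hy).trans ((le_max_left _ _).trans (le_max_left _ _)),
      (le_max_right _ _).trans (le_max_left _ _),
      (le_max_left _ _).trans (le_max_right _ _), ?_⟩
    refine le_trans ?_ ((le_max_right _ _).trans (le_max_right _ _))
    refine (norm_add_le _ _).trans (add_le_add (hinv _ y hy) ?_)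
    rw [norm_mul, Complex.norm_of_nonneg (hIoo y hy).1.le]
    exact mul_le_of_le_one_right (norm_nonneg _) (hIoo y hy).2.le
  · obtain ⟨hg, hh⟩ := h₂ y (hIoo y hy)
    exact ⟨(hg.const_mul k).congr_deriv (by ring), (hh.const_mul k).congr_deriv (by ring)⟩

theorem IsSolution.exists_circMean_eq {s t r : ℂ} {u v : ℂ → ℂ} (hu : IsSolution s t r u)
    (hv : IsSolution s t r v) (m : ℤ) (hne : ∀ᶠ x in 𝓝[>] (0 : ℝ), circMean m v x ≠ 0) :
    ∃ k : ℂ, ∀ x ∈ Set.Ioo (0 : ℝ) 1, circMean m u x = k * circMean m v x := by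
  have h0 : |(0 : ℝ)| < 1 := by simp
  exact RadialSystem.exists_eq_const_mul (fun x hx => hu.radialSystem m hx)
    (fun x hx => hv.radialSystem m hx)
    (hasDerivAt_circMean m hu.contDiffOn_one h0).continuousAt
    (hasDerivAt_circMean (m + 1) hu.contDiffOn_dbar h0).continuousAt
    (hasDerivAt_circMean m hv.contDiffOn_one h0).continuousAt
    (hasDerivAt_circMean (m + 1) hv.contDiffOn_dbar h0).continuousAt hne

/-! ### The normalised homogeneous solutions -/

theorem term_eq_mul (s t r : ℂ) (k : ℤ → ℂ) (m : ℤ) (z : ℂ) :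
    term s t r k m z = k m * term s t r 1 m z := by
  simp only [term, Pi.one_apply, one_mul]
  split_ifs <;> ring

theorem rootCondition_one : RootCondition 1 :=
  rootCondition_of_bounded fun R hR hR1 =>
    ⟨1, Eventually.of_forall fun m => by simpa using pow_le_one₀ hR.le hR1.le⟩

theorem isSolution_term (s t r : ℂ) (m : ℤ) : IsSolution s t r (term s t r 1 m) := by
  have hc := (rootCondition_one.discSummable s t r).restr 0 {m}
  have hE : term s t r 1 m = dblSum (restr 0 {m} (expCoeff s t r 1)) :=
    funext fun z => term_eq_dblSum _ _ _ _ _ _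
  rw [hE]
  refine ⟨hc.contDiffOn_nat 2, fun z hz => hc.opM_eq_zero (fun p q => ?_) hz⟩
  have e : ((p + 1 : ℕ) : ℤ) - (q + 1 : ℕ) + 0 = p - q + 0 := by push_cast; ring
  simp only [restr_singleton]
  rw [e]
  split_ifs
  · exact expCoeff_succ s t r 1 p q
  · simp

theorem term_circle (s t r : ℂ) (k : ℤ → ℂ) (m : ℤ) (x θ : ℝ) :
    term s t r k m (x * Complex.exp (θ * Complex.I)) =
      term s t r k m x * Complex.exp (m * θ * Complex.I) := by
  have hn : ‖(x : ℂ) * Complex.exp (θ * Complex.I)‖ = ‖(x : ℂ)‖ := by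
    rw [norm_circle, Complex.norm_real, Real.norm_eq_abs]
  rcases le_or_gt 0 m with h | h
  · obtain ⟨n, rfl⟩ := Int.eq_ofNat_of_zero_le h
    rw [term_natCast, term_natCast, hn, mul_pow, ← Complex.exp_nat_mul]
    push_cast
    ring_nf
  · obtain ⟨n, hn'⟩ := Int.eq_ofNat_of_zero_le (a := -m) (by omega)
    obtain rfl : m = -(n : ℤ) := by omega
    rw [term_neg _ _ _ _ (by omega), term_neg _ _ _ _ (by omega), hn, map_mul, mul_pow,
      conj_exp_mul_I, ← Complex.exp_nat_mul]
    push_cast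
    ring_nf

theorem circMean_term (s t r : ℂ) (m : ℤ) (x : ℝ) :
    circMean m (term s t r 1 m) x = term s t r 1 m x := by
  have h : ∀ θ : ℝ, term s t r 1 m (x * Complex.exp (θ * Complex.I)) *
      Complex.exp (-(m * θ * Complex.I)) = term s t r 1 m x := fun θ => by
    rw [term_circle, mul_assoc, ← Complex.exp_add, add_neg_cancel, Complex.exp_zero, mul_one]
  have hpi : (Real.pi : ℂ) ≠ 0 := Complex.ofReal_ne_zero.2 Real.pi_ne_zero
  simp only [circMean, h, intervalIntegral.integral_const, sub_zero, Complex.real_smul]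
  push_cast
  field_simp

theorem norm_hypCoeff_mul_pow_le (s t r : ℂ) (m n : ℕ) {x : ℂ} (hx : ‖x‖ ≤ 1) :
    ‖hypCoeff s t r m n * x ^ n‖ ≤ (‖s‖ + ‖t‖ + ‖r‖) ^ n / n.factorial := by
  rw [norm_mul, norm_pow]
  exact (mul_le_of_le_one_right (norm_nonneg _) (pow_le_one₀ (norm_nonneg _) hx)).trans
    (norm_hypCoeff_le s t r m n)

theorem tendsto_calP_zero (s t r : ℂ) (m : ℕ) :
    Tendsto (fun x : ℂ => calP (r + s * m) (s + t) (m + 1) x) (𝓝 0) (𝓝 1) := by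
  simp only [calP_eq]
  have h : ∑' n : ℕ, hypCoeff s t r m n * (0 : ℂ) ^ n = 1 := by
    rw [tsum_eq_single 0 fun n hn => by simp [hn]]
    simp [hypCoeff, poch]
  rw [← h]
  refine tendsto_tsum_of_dominated_convergence
    (Real.summable_pow_div_factorial (‖s‖ + ‖t‖ + ‖r‖)) (fun n => ?_) ?_
  · exact (Continuous.tendsto (by fun_prop) _)
  · filter_upwards [Metric.closedBall_mem_nhds (0 : ℂ) one_pos] with x hx n
    exact norm_hypCoeff_mul_pow_le s t r m n (by simpa using hx)

theorem tendsto_hypCoeff (s t r : ℂ) (n : ℕ) :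
    Tendsto (fun m : ℕ => hypCoeff s t r m n) atTop (𝓝 (s ^ n / n.factorial)) := by
  induction n with
  | zero => simp [hypCoeff, poch]
  | succ n ih =>
    -- This is the quotient $(s(m+n)+tn+r)/(m+n+1)$, split into its limit and a remainder.
    have h1 : Tendsto (fun m : ℕ => s + (t * n + r - s) / ((m + (n + 1) : ℕ) : ℂ)) atTop
        (𝓝 (s + 0)) :=
      tendsto_const_nhds.add ((tendsto_const_div_atTop_nhds_zero_nat _).comp
        (tendsto_add_atTop_nat (n + 1)))
    have h2 := (h1.mul ih).div_const ((n + 1 : ℕ) : ℂ)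
    have hn : ((n + 1 : ℕ) : ℂ) ≠ 0 := Nat.cast_ne_zero.2 (by omega)
    convert h2 using 1
    · funext m
      have hm : ((m + (n + 1) : ℕ) : ℂ) ≠ 0 := Nat.cast_ne_zero.2 (by omega)
      have h := hypCoeff_succ s t r m n
      rw [add_assoc] at h
      field_simp
      push_cast at h ⊢
      linear_combination h
    · rw [Nat.factorial_succ]
      push_cast at hn ⊢
      have : (n.factorial : ℂ) ≠ 0 := Nat.cast_ne_zero.2 n.factorial_ne_zero
      field_simp
      rw [add_zero, pow_succ']

theorem tendsto_calP_atTop (s t r : ℂ) {x : ℂ} (hx : ‖x‖ ≤ 1) :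
    Tendsto (fun m : ℕ => calP (r + s * m) (s + t) (m + 1) x) atTop
      (𝓝 (Complex.exp (s * x))) := by
  simp only [calP_eq]
  rw [Complex.exp_eq_exp_ℂ, NormedSpace.exp_eq_tsum_div]
  refine tendsto_tsum_of_dominated_convergence
    (Real.summable_pow_div_factorial (‖s‖ + ‖t‖ + ‖r‖)) (fun n => ?_)
    (Eventually.of_forall fun m n => norm_hypCoeff_mul_pow_le s t r m n hx)
  have := (tendsto_hypCoeff s t r n).mul_const (x ^ n)
  rwa [div_mul_eq_mul_div, ← mul_pow] at this

theorem norm_sq_ofReal_le_one {R : ℝ} (hR : 0 < R) (hR1 : R < 1) :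
    ‖((‖(R : ℂ)‖ : ℂ) ^ 2)‖ ≤ 1 := by
  rw [norm_pow, Complex.norm_real, norm_norm, Complex.norm_real, Real.norm_of_nonneg hR.le]
  exact pow_le_one₀ hR.le hR1.le

theorem eventually_cofinite_int {p : ℤ → Prop} (h1 : ∀ᶠ n : ℕ in atTop, p n)
    (h2 : ∀ᶠ n : ℕ in atTop, p (-n)) : ∀ᶠ m in cofinite, p m := by
  rw [Int.cofinite_eq, eventually_sup]
  obtain ⟨N, hN⟩ := eventually_atTop.1 h1
  obtain ⟨N', hN'⟩ := eventually_atTop.1 h2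
  constructor
  · filter_upwards [eventually_le_atBot (-(N' : ℤ))] with m hm
    have := hN' m.natAbs (by omega)
    rwa [show -((m.natAbs : ℕ) : ℤ) = m by omega] at this
  · filter_upwards [eventually_ge_atTop (N : ℤ)] with m hm
    have := hN m.natAbs (by omega)
    rwa [show ((m.natAbs : ℕ) : ℤ) = m by omega] at this

/-- The factor $\mathcal P$ may vanish for some $m$, but its limits $e^{sR^2}$ and $e^{tR^2}$ do
not; half their moduli bound it below for large $|m|$. -/
theorem exists_lower_bound_term (s t r : ℂ) {R : ℝ} (hR : 0 < R) (hR1 : R < 1) :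
    ∃ δ : ℝ, 0 < δ ∧ ∀ᶠ m : ℤ in cofinite, δ * R ^ m.natAbs ≤ ‖term s t r 1 m R‖ := by
  have hx := norm_sq_ofReal_le_one hR hR1
  set x : ℂ := (‖(R : ℂ)‖ : ℂ) ^ 2 with hxdef
  have pos : ∀ w : ℂ, 0 < ‖Complex.exp w‖ := fun w => norm_pos_iff.2 (Complex.exp_ne_zero w)
  have e1 := (tendsto_calP_atTop s t r hx).norm.eventually_const_le (half_lt_self (pos (s * x)))
  have e2 := (tendsto_calP_atTop t s r hx).norm.eventually_const_le (half_lt_self (pos (t * x)))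
  have hRn : ‖(R : ℂ)‖ = R := Complex.norm_of_nonneg hR.le
  refine ⟨min (‖Complex.exp (s * x)‖ / 2) (‖Complex.exp (t * x)‖ / 2),
    lt_min (half_pos (pos _)) (half_pos (pos _)), eventually_cofinite_int ?_ ?_⟩
  · filter_upwards [e1] with n hn
    rw [term_natCast, ← hxdef, Pi.one_apply, one_mul, norm_mul, norm_pow, hRn, Int.natAbs_natCast]
    gcongr
    exact (min_le_left _ _).trans hn
  · filter_upwards [e2, eventually_ge_atTop 1] with n hn hn1
    rw [term_neg _ _ _ _ hn1, ← hxdef, Pi.one_apply, one_mul, norm_mul, norm_pow,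
      RCLike.norm_conj, hRn, Int.natAbs_neg, Int.natAbs_natCast]
    gcongr
    exact (min_le_right _ _).trans hn

theorem eventually_term_ne_zero (s t r : ℂ) (m : ℤ) :
    ∀ᶠ x : ℝ in 𝓝[>] (0 : ℝ), term s t r 1 m x ≠ 0 := by
  have hsq : Tendsto (fun x : ℝ => (‖(x : ℂ)‖ : ℂ) ^ 2) (𝓝[>] 0) (𝓝 0) := by
    have : Continuous fun x : ℝ => (‖(x : ℂ)‖ : ℂ) ^ 2 := by fun_prop
    simpa using (this.tendsto 0).mono_left (nhdsWithin_le_nhds (s := Set.Ioi 0))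
  have hne : ∀ s t : ℂ, ∀ n : ℕ, ∀ᶠ x : ℝ in 𝓝[>] (0 : ℝ),
      calP (r + s * n) (s + t) (n + 1) ((‖(x : ℂ)‖ : ℂ) ^ 2) ≠ 0 := fun s t n =>
    ((tendsto_calP_zero s t r n).comp hsq).eventually_ne one_ne_zero
  rcases le_or_gt 0 m with h | h
  · obtain ⟨n, rfl⟩ := Int.eq_ofNat_of_zero_le h
    filter_upwards [hne s t n, self_mem_nhdsWithin] with x hx hx0
    have hx0' : (x : ℂ) ≠ 0 := Complex.ofReal_ne_zero.2 (Set.mem_Ioi.1 hx0).ne'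
    rw [term_natCast, Pi.one_apply, one_mul]
    exact mul_ne_zero hx (pow_ne_zero _ hx0')
  · obtain ⟨n, hn⟩ := Int.eq_ofNat_of_zero_le (a := -m) (by omega)
    obtain rfl : m = -(n : ℤ) := by omega
    filter_upwards [hne t s n, self_mem_nhdsWithin] with x hx hx0
    have hx0' : (x : ℂ) ≠ 0 := Complex.ofReal_ne_zero.2 (Set.mem_Ioi.1 hx0).ne'
    rw [term_neg _ _ _ _ (by omega), Pi.one_apply, one_mul, Complex.conj_ofReal]
    exact mul_ne_zero hx (pow_ne_zero _ hx0')

/-! ### Expansion of solutions -/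

theorem hasSum_circMean {u : ℂ → ℂ} (hu : ContinuousOn u disc) {x : ℝ} (hx : |x| < 1)
    (hs : Summable fun m : ℤ => circMean m u x) (θ : ℝ) :
    HasSum (fun m : ℤ => circMean m u x * Complex.exp (m * θ * Complex.I))
      (u (x * Complex.exp (θ * Complex.I))) := by
  have : Fact (0 < 2 * Real.pi) := ⟨Real.two_pi_pos⟩
  have hpi : (Real.pi : ℂ) ≠ 0 := Complex.ofReal_ne_zero.2 Real.pi_ne_zero
  let f : C(AddCircle (2 * Real.pi), ℂ) :=
    ⟨fun y => u (x * (AddCircle.toCircle y : ℂ)), hu.comp_continuous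
      (continuous_const.mul (continuous_subtype_val.comp AddCircle.continuous_toCircle))
      fun y => by rw [mem_disc, norm_mul, Circle.norm_coe, mul_one, Complex.norm_real]; exact hx⟩
  have hf : ∀ θ : ℝ, f (θ : AddCircle (2 * Real.pi)) = u (x * Complex.exp (θ * Complex.I)) := by
    intro θ
    simp only [f, ContinuousMap.coe_mk, AddCircle.toCircle_apply_mk, Circle.coe_exp]
    rw [div_self Real.two_pi_pos.ne', one_mul]
  have hfour : ∀ (m : ℤ) (θ : ℝ), fourier m (θ : AddCircle (2 * Real.pi)) =
      Complex.exp (m * θ * Complex.I) := by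
    intro m θ
    rw [fourier_coe_apply]
    congr 1
    push_cast
    field_simp
  have hcoeff : ∀ m : ℤ, fourierCoeff f m = circMean m u x := by
    intro m
    rw [fourierCoeff_eq_intervalIntegral _ _ 0, zero_add, circMean, Complex.real_smul]
    push_cast
    congr 2
    funext θ
    rw [hf, hfour, smul_eq_mul, mul_comm]
    congr 2
    push_cast
    ring
  have h := has_pointwise_sum_fourier_series_of_summable (f := f)
    (hs.congr fun m => (hcoeff m).symm) (θ : AddCircle (2 * Real.pi))
  rw [hf] at h
  exact h.congr_fun fun m => by rw [hcoeff, hfour, smul_eq_mul]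

theorem IsSolution.exists_expansion {s t r : ℂ} {u : ℂ → ℂ} (hu : IsSolution s t r u) :
    ∃ k : ℤ → ℂ, RootCondition k ∧ Set.EqOn u (dblSum (expCoeff s t r k)) disc := by
  have hex : ∀ m : ℤ, ∃ k : ℂ, ∀ x ∈ Set.Ioo (0 : ℝ) 1,
      circMean m u x = k * term s t r 1 m x := fun m => by
    have := hu.exists_circMean_eq (isSolution_term s t r m) m (by
      simpa only [circMean_term] using eventually_term_ne_zero s t r m)
    simpa only [circMean_term] using this
  choose k hk using hex
  have hroot : RootCondition k := by
    refine rootCondition_of_bounded fun R hR hR1 => ?_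
    obtain ⟨δ, hδ, hlow⟩ := exists_lower_bound_term s t r hR hR1
    obtain ⟨C, hC⟩ := exists_bound_closedBall hu.1.continuousOn hR1
    refine ⟨C / δ, ?_⟩
    filter_upwards [hlow] with m hm
    rw [le_div_iff₀ hδ]
    calc ‖k m‖ * R ^ m.natAbs * δ = ‖k m‖ * (δ * R ^ m.natAbs) := by ring
      _ ≤ ‖k m‖ * ‖term s t r 1 m R‖ := by gcongr
      _ = ‖circMean m u R‖ := by rw [hk m R ⟨hR, hR1⟩, norm_mul]
      _ ≤ C := norm_circMean_le m fun z hz => hC z (by rw [hz, abs_of_pos hR])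
  have hc := hroot.discSummable s t r
  have hne : ∀ z ∈ disc, z ≠ 0 → u z = dblSum (expCoeff s t r k) z := by
    intro z hz hz0
    have hx : ‖z‖ ∈ Set.Ioo (0 : ℝ) 1 := ⟨norm_pos_iff.2 hz0, mem_disc.1 hz⟩
    have hx1 : |‖z‖| < 1 := by rw [abs_of_pos hx.1]; exact hx.2
    have hterm : ∀ m, circMean m u ‖z‖ = term s t r k m (‖z‖ : ℂ) := fun m => by
      rw [hk m _ hx, ← term_eq_mul]
    have hsum := (hroot.hasSum_term s t r (z := (‖z‖ : ℂ)) (by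
      rw [mem_disc, Complex.norm_real, norm_norm]; exact hx.2)).summable
    have h := hasSum_circMean hu.1.continuousOn hx1 (hsum.congr fun m => (hterm m).symm) z.arg
    rw [Complex.norm_mul_exp_arg_mul_I] at h
    refine h.unique ((hroot.hasSum_term s t r hz).congr_fun fun m => ?_)
    rw [hterm, ← term_circle, Complex.norm_mul_exp_arg_mul_I]
  refine ⟨k, hroot, fun z hz => ?_⟩
  -- The proportionality holds only for positive radii, so the origin is reached by continuity of
  -- both sides.
  rcases eq_or_ne z 0 with rfl | hz0
  · have hn := isOpen_disc.mem_nhds hz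
    have h1 := ((hu.1.continuousOn.continuousAt hn).tendsto).mono_left
      (nhdsWithin_le_nhds (s := {0}ᶜ))
    have h2 := ((hc.contDiffOn.continuousOn.continuousAt hn).tendsto).mono_left
      (nhdsWithin_le_nhds (s := {0}ᶜ))
    refine tendsto_nhds_unique (h1.congr' ?_) h2
    filter_upwards [nhdsWithin_le_nhds hn, self_mem_nhdsWithin] with w hw hw0
    exact hne w hw hw0
  · exact hne z hz hz0

end GenHarm

end

/-! ### The main theorem -/

theorem mainTheorem1 (s t r : ℂ) :
    (∀ u : ℂ → ℂ, GenHarm.IsSolution s t r u ↔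
      ∃ k : ℤ → ℂ, GenHarm.RootCondition k ∧
        ∀ z ∈ GenHarm.disc, ∃ a b : ℂ,
          HasSum (fun m : ℕ =>
            k m * GenHarm.calP (r + s * m) (s + t) (m + 1) ((‖z‖ : ℂ) ^ 2) * z ^ m) a ∧
          HasSum (fun m : {m : ℕ // 1 ≤ m} =>
            k (-(m : ℤ)) * GenHarm.calP (r + t * (m : ℕ)) (t + s) ((m : ℕ) + 1)
              ((‖z‖ : ℂ) ^ 2) * starRingEnd ℂ z ^ (m : ℕ)) b ∧
          u z = a + b) ∧
    (∀ k : ℤ → ℂ, GenHarm.RootCondition k →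
      GenHarm.AbsConvergent (GenHarm.term s t r k) ∧
      GenHarm.HasSmoothSum (GenHarm.term s t r k)
        (fun z => ∑' m : ℤ, GenHarm.term s t r k m z)) := by
  refine ⟨fun u => ⟨fun hu => ?_, ?_⟩, fun k hk => ?_⟩
  · obtain ⟨k, hk, hE⟩ := hu.exists_expansion
    refine ⟨k, hk, fun z hz => ?_⟩
    have hs := hk.hasSum_term s t r hz
    have ha := (hs.summable.comp_injective (i := fun m : ℕ => (m : ℤ))
      Nat.cast_injective).hasSum
    have hb := (hs.summable.comp_injective
      (i := fun m : {m : ℕ // 1 ≤ m} => -((m : ℕ) : ℤ))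
      (fun a b h => Subtype.ext (by simpa using h))).hasSum
    refine ⟨_, _, ha.congr_fun fun m => (GenHarm.term_natCast s t r k m z).symm,
      hb.congr_fun fun m => (GenHarm.term_neg s t r k m.2 z).symm, ?_⟩
    rw [hE hz]
    exact hs.unique (GenHarm.hasSum_int_of_nat_of_pos ha hb)
  · rintro ⟨k, hk, h⟩
    refine hk.isSolution s t r fun z hz => ?_
    obtain ⟨a, b, ha, hb, hab⟩ := h z hz
    rw [hab]
    -- The two one-sided sums join to a sum over $\mathbb Z$, which the double series also computes.
    refine HasSum.unique (GenHarm.hasSum_int_of_nat_of_pos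
      (f := fun m => GenHarm.term s t r k m z)
      (ha.congr_fun fun m => GenHarm.term_natCast s t r k m z)
      (hb.congr_fun fun m => GenHarm.term_neg s t r k m.2 z)) (hk.hasSum_term s t r hz)
  · have hc := hk.discSummable s t r
    have hf : ∀ m, Set.EqOn (GenHarm.term s t r k m)
        (GenHarm.dblSum (GenHarm.restr 0 {m} (GenHarm.expCoeff s t r k))) GenHarm.disc :=
      fun m z _ => GenHarm.term_eq_dblSum s t r k m z
    exact ⟨hc.absConvergent hf, hc.hasSmoothSum hf fun z hz => (hk.hasSum_term s t r hz).tsum_eq⟩
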